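/- Let $(G,b,w)$ be an instance of the multiple partners assignment problem (MPA): $G=(N,E)$ is a finite simple bipartite graph with partition classes $I$ (sellers) and $J$ (buyers), $N=I\cup J$, $b:N\to\mathbb{Z}_{\ge 0}$ is a capacity function, and $w:E\to\mathbb{R}_{\ge 0}$. A $b$-matching is a set $M\subseteq E$ such that every player $i$ is incident with at most $b(i)$ edges of $M$. A stable solution is a pair $(M,p)$ of a $b$-matching $M$ and a function $p:N\times N\to\mathbb{R}_{\ge 0}$ (payoff vector) with $p(i,j)+p(j,i)=w(ij)$ for $ij\in M$ and $p(i,j)=p(j,i)=0$ for $ij\notin M$, such that $u_p(i)+u_p(j)\ge w(ij)$ for all $ij\in E\setminus M$. Here $u_p(i)=\min\{p(i,j): ij\in M\}$ if $i$ is incident with exactly $b(i)$ edges of $M$ (with $\min\emptyset=+\infty$, so that a player of capacity $0$ never blocks), and $u_p(i)=0$ otherwise. The payoff vectors $p,\hat p$ of two stable solutions $(M,p),(\hat M,\hat p)$ are equivalent if $u_p=u_{\hat p}$; $p(i,j)=\hat p(i,j)$ and $p(j,i)=\hat p(j,i)$ for $ij\in M\cap\hat M$; $p(i,j)=u_p(i)$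 and $p(j,i)=u_p(j)$ for $ij\in M\setminus\hat M$; and $\hat p(i,j)=u_{\hat p}(i)$ and $\hat p(j,i)=u_{\hat p}(j)$ for $ij\in\hat M\setminus M$. Equivalent payoff vectors are identified. For payoff vectors $p,q$ of stable solutions $(M,p),(M,q)$ with a common matching write $p\le q$ if $q(i,j)\le p(i,j)$ for all $i\in I$, $j\in N$, and $p(j,i)\le q(j,i)$ for all $j\in J$, $i\in N$; for classes $x,y$ write $x\le y$ if $x$ and $y$ have representatives $p\le q$ with a common matching. A stable solution $(M,p)$ is optimal for a set $S$ of players if there is no stable solution $(M',p')$ with $\sum_{j:ij\in E}p'(i,j)>\sum_{j:ij\in E}p(i,j)$ for some $i\in S$. Then the payoff vectors of stable solutions of $(G,b,w)$, up to equivalence, form a complete lattice with unique optimal outcomes for each side of the market. More precisely: (a) For every maximum weight $b$-matching $M$, every equivalence class contains exactly one payoff vector $p$ such that $(M,p)$ is a stable solution; and for any two stable solutions $(M,p)$, $(M,q)$ with a common matching, the class of $p$ is at most the class of $q$ if and only if $p\le q$. (b) The relation $\le$ on the set of equivalence classes is a partial order, and with it this set is a complete lattice (every subset has a supremum and an infimum;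 in particular the set is non-empty). If $(M,p)$ and $(M,q)$ are stable solutions, then so are $(M,p\vee q)$ and $(M,p\wedge q)$, and the classes of $p\vee q$ and $p\wedge q$ are the join and the meet of the classes of $p$ and $q$, where for $i\in I$, $j\in J$: $[p\vee q](i,j)=\min\{p(i,j),q(i,j)\}$, $[p\vee q](j,i)=\max\{p(j,i),q(j,i)\}$, $[p\wedge q](i,j)=\max\{p(i,j),q(i,j)\}$, $[p\wedge q](j,i)=\min\{p(j,i),q(j,i)\}$ (all other entries are $0$). (c) A stable solution is optimal for $I$ if and only if the class of its payoff vector is the least element of the lattice, and optimal for $J$ if and only if it is the greatest element. -/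

import Mathlib

/-- An instance `(G, b, w)` of the multiple partners assignment problem on the player set `N`:
a bipartite graph `G` with partition classes `I` (sellers) and `J` (buyers), a capacity function
`b` and an edge weighting `w` (only its values on the edges of `G` matter). -/
structure MPAInstance (N : Type*) where
  G : SimpleGraph N
  I : Set N
  J : Set N
  bipartite : G.IsBipartiteWith I J
  cover : I ∪ J = Set.univ
  b : N → ℕ
  w : Sym2 N → ℝ
  w_nonneg : ∀ e ∈ G.edgeSet, 0 ≤ w e

namespace MPAInstance

variable {N : Type*} [Fintype N]

open scoped Classical in
/-- The partners of the player `i` under a set `M` of edges. -/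
noncomputable def partners (M : Finset (Sym2 N)) (i : N) : Finset N :=
  Finset.univ.filter fun j => s(i, j) ∈ M

/-- `M` is a `b`-matching: a set of edges such that every player `i` is incident with at most
`b i` of them. -/
def IsBMatching (Γ : MPAInstance N) (M : Finset (Sym2 N)) : Prop :=
  (∀ e ∈ M, e ∈ Γ.G.edgeSet) ∧ ∀ i, (partners M i).card ≤ Γ.b i

/-- `M` is a `b`-matching of maximum weight. -/
def IsMaxWeightBMatching (Γ : MPAInstance N) (M : Finset (Sym2 N)) : Prop :=
  Γ.IsBMatching M ∧ ∀ M', Γ.IsBMatching M' → ∑ e ∈ M', Γ.w e ≤ ∑ e ∈ M, Γ.w e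

/-- `p` is a payoff vector compatible with `M`. -/
def IsPayoff (Γ : MPAInstance N) (M : Finset (Sym2 N)) (p : N → N → ℝ) : Prop :=
  (∀ i j, 0 ≤ p i j) ∧
  (∀ i j, s(i, j) ∈ M → p i j + p j i = Γ.w s(i, j)) ∧
  (∀ i j, s(i, j) ∉ M → p i j = 0)

open scoped Classical in
/-- The utility of the player `i`: the worst payoff over her partners if she is saturated by `M`,
and `0` otherwise. The value is a real number if `b i` is positive; a player of capacity `0` is
saturated without having a partner, and the minimum over the empty set is `⊤`: she never
blocks. -/
noncomputable def utility (Γ : MPAInstance N) (M : Finset (Sym2 N)) (p : N → N → ℝ) (i : N) :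
    WithTop ℝ :=
  if (partners M i).card = Γ.b i then (partners M i).inf fun j => ((p i j : ℝ) : WithTop ℝ)
  else 0

/-- The pair `i, j` blocks `(M, p)`. -/
def Blocks (Γ : MPAInstance N) (M : Finset (Sym2 N)) (p : N → N → ℝ) (i j : N) : Prop :=
  Γ.G.Adj i j ∧ s(i, j) ∉ M ∧
    Γ.utility M p i + Γ.utility M p j < ((Γ.w s(i, j) : ℝ) : WithTop ℝ)

/-- `(M, p)` is a stable solution. -/
def IsStable (Γ : MPAInstance N) (M : Finset (Sym2 N)) (p : N → N → ℝ) : Prop :=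
  Γ.IsBMatching M ∧ Γ.IsPayoff M p ∧ ∀ i j, ¬ Γ.Blocks M p i j

/-- The stable solutions of `Γ`. -/
@[ext]
structure StableSolution (Γ : MPAInstance N) where
  matching : Finset (Sym2 N)
  payoff : N → N → ℝ
  stable : Γ.IsStable matching payoff

open scoped Classical in
/-- The total payoff of the player `i`. -/
noncomputable def totalPayoff (Γ : MPAInstance N) (p : N → N → ℝ) (i : N) : ℝ :=
  ∑ j ∈ Finset.univ.filter (fun j => Γ.G.Adj i j), p i j

/-- A stable solution is optimal for the set `S` of players if no stable solution gives some
player of `S` a larger total payoff. -/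
def IsOptimalFor (Γ : MPAInstance N) (S : Set N) (s : Γ.StableSolution) : Prop :=
  ¬ ∃ t : Γ.StableSolution, ∃ i ∈ S, Γ.totalPayoff s.payoff i < Γ.totalPayoff t.payoff i

/-- Equivalence of the payoff vectors of the stable solutions `s` and `t`: every player has the
same utility, the payoffs agree on the common pairs, and on all other pairs every player
receives exactly her utility. -/
def Equivalent (Γ : MPAInstance N) (s t : Γ.StableSolution) : Prop :=
  (∀ i, Γ.utility s.matching s.payoff i = Γ.utility t.matching t.payoff i) ∧
  (∀ i j, s(i, j) ∈ s.matching → s(i, j) ∈ t.matching → s.payoff i j = t.payoff i j) ∧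
  (∀ i j, s(i, j) ∈ s.matching → s(i, j) ∉ t.matching →
    ((s.payoff i j : ℝ) : WithTop ℝ) = Γ.utility s.matching s.payoff i) ∧
  (∀ i j, s(i, j) ∈ t.matching → s(i, j) ∉ s.matching →
    ((t.payoff i j : ℝ) : WithTop ℝ) = Γ.utility t.matching t.payoff i)

theorem Equivalent.isEquivalence (Γ : MPAInstance N) : Equivalence Γ.Equivalent where
  refl s := ⟨fun _ => rfl, fun _ _ _ _ => rfl, fun _ _ h h' => absurd h h',
    fun _ _ h h' => absurd h h'⟩
  symm := by
    rintro s t ⟨h1, h2, h3, h4⟩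
    exact ⟨fun i => (h1 i).symm, fun i j h h' => (h2 i j h' h).symm, h4, h3⟩
  trans := by
    rintro s t r ⟨h1, h2, h3, h4⟩ ⟨k1, k2, k3, k4⟩
    refine ⟨fun i => (h1 i).trans (k1 i), fun i j hs hr => ?_, fun i j hs hr => ?_,
      fun i j hr hs => ?_⟩
    · by_cases ht : s(i, j) ∈ t.matching
      · exact (h2 i j hs ht).trans (k2 i j ht hr)
      · have e := (h3 i j hs ht).trans ((h1 i).trans ((k1 i).trans (k4 i j hr ht).symm))
        exact_mod_cast e
    · by_cases ht : s(i, j) ∈ t.matching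
      · rw [h2 i j hs ht, h1 i]
        exact k3 i j ht hr
      · exact h3 i j hs ht
    · by_cases ht : s(i, j) ∈ t.matching
      · rw [← k2 i j ht hr, ← k1 i]
        exact h4 i j ht hs
      · exact k4 i j hr ht

/-- Equivalence of stable solutions as a setoid. -/
def stableSetoid (Γ : MPAInstance N) : Setoid Γ.StableSolution :=
  ⟨Γ.Equivalent, Equivalent.isEquivalence Γ⟩

/-- The payoff vectors of the stable solutions, where equivalent ones are identified. -/
def StablePayoff (Γ : MPAInstance N) : Type _ := Quotient Γ.stableSetoid

/-- The class of the payoff vector of a stable solution. -/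
def StableSolution.toPayoff {Γ : MPAInstance N} (s : Γ.StableSolution) : Γ.StablePayoff :=
  Quotient.mk Γ.stableSetoid s

/-- No seller receives more, and no buyer receives less, from any partner under `q` than
under `p`. -/
def PayoffLE (Γ : MPAInstance N) (p q : N → N → ℝ) : Prop :=
  (∀ i ∈ Γ.I, ∀ j, q i j ≤ p i j) ∧ (∀ j ∈ Γ.J, ∀ i, p j i ≤ q j i)

/-- The order on the stable payoff vectors: they are compared pair by pair, through
representatives with the same matching. -/
def StablePayoffLE (Γ : MPAInstance N) (x y : Γ.StablePayoff) : Prop :=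
  ∃ s t : Γ.StableSolution, s.toPayoff = x ∧ t.toPayoff = y ∧
    s.matching = t.matching ∧ Γ.PayoffLE s.payoff t.payoff

open scoped Classical in
/-- The payoff-wise join: minimum for the sellers, maximum for the buyers. -/
noncomputable def joinPayoff (Γ : MPAInstance N) (p q : N → N → ℝ) (i j : N) : ℝ :=
  if i ∈ Γ.I then min (p i j) (q i j) else max (p i j) (q i j)

open scoped Classical in
/-- The payoff-wise meet: maximum for the sellers, minimum for the buyers. -/
noncomputable def meetPayoff (Γ : MPAInstance N) (p q : N → N → ℝ) (i j : N) : ℝ :=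
  if i ∈ Γ.I then max (p i j) (q i j) else min (p i j) (q i j)

end MPAInstance

/-! The theorem is linear programming duality. A stable solution `(M, p)` promises each player `i`
an amount for every possible partner: the payoff if they are matched, the utility of `i` otherwise.
Stability says that the two promises on an edge cover its weight, provided both ends have positive
capacity. Summing over any `b`-matching `M'` writes `w(M) - w(M')` as a sum of nonnegative slacks
(`IsStable.sum_excess`). So `M` has maximum weight, and if `M'` has maximum weight too, all slacks
vanish (`IsStable.slackness`).

In that case paying the promises along `M'` gives a stable solution equivalent to `(M, p)`
(`IsStable.transfer`). Hence each class has exactly one representative on each maximum weight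
matching, and everything can be checked on a single fixed `M`.

On a fixed `M`, the payoffs of a pair sum to a constant, so infima on one side go with suprema on
the other. Stability survives this operation (`IsSides.isStable_of_isGLB`), which gives all nonempty
bounds and the formulas for join and meet. Nonemptiness (`IsMaxWeightBMatching.exists_isStable`)
comes from a dual solution, read off a potential of the residual digraph of a maximum weight
matching. A side-optimal solution cannot be improved in total payoff, so it agrees pair by pair with
the extreme element. -/

/-! ### Feasible potentials in finite digraphs -/

section Potential

variable {V : Type*}

/-- The cost of a walk, given as the list of its vertices from the last one to the first one. -/
def walkCost (c : V → V → ℝ) : List V → ℝ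
  | [] => 0
  | [_] => 0
  | a :: b :: l => c b a + walkCost c (b :: l)

theorem walkCost_append (c : V → V → ℝ) (l : List V) (v : V) (t : List V) :
    walkCost c (l ++ v :: t) = walkCost c (l ++ [v]) + walkCost c (v :: t) := by
  induction l with
  | nil => simp [walkCost]
  | cons a l ih =>
    cases l with
    | nil => simp [walkCost]
    | cons b l =>
      simp only [List.cons_append, walkCost] at ih ⊢
      rw [ih]; ring

variable [DecidableEq V]

theorem formPerm_cons_cons_apply {a b : V} {t : List V} (h : (a :: b :: t).Nodup) (v : V) :
    (a :: b :: t).formPerm v =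
      if v = a then b
      else if v = (b :: t).getLast (List.cons_ne_nil _ _) then a else (b :: t).formPerm v := by
  have ha : a ∉ b :: t := (List.nodup_cons.1 h).1
  have hτa : (b :: t).formPerm a = a := List.formPerm_apply_of_notMem ha
  have hτx : (b :: t).formPerm ((b :: t).getLast (List.cons_ne_nil _ _)) = b :=
    List.formPerm_apply_getLast b t
  rw [List.formPerm_cons_cons, Equiv.Perm.mul_apply]
  split_ifs with h1 h2
  · rw [h1, hτa, Equiv.swap_apply_left]
  · rw [h2, hτx, Equiv.swap_apply_right]
  · refine Equiv.swap_apply_of_ne_of_ne (fun e => h1 ?_) (fun e => h2 ?_)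
    · exact (b :: t).formPerm.injective (e.trans hτa.symm)
    · exact (b :: t).formPerm.injective (e.trans hτx.symm)

/-- As walks are listed backwards, `formPerm` sends each vertex of the walk to its predecessor, and
the first vertex of the walk to its end: the sum is the cost of the closed walk. In the induction,
prepending `a` replaces the closing arc from `b` to `x` by the arcs from `b` to `a` and from `a` to
`x`. -/
theorem sum_formPerm [Fintype V] (c : V → V → ℝ) (hc : ∀ v, c v v = 0) (l : List V) (a : V)
    (h : (a :: l).Nodup) :
    ∑ v, c ((a :: l).formPerm v) v =
      walkCost c (a :: l) + c a ((a :: l).getLast (List.cons_ne_nil _ _)) := by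
  induction l generalizing a with
  | nil => simp [walkCost, hc]
  | cons b t ih =>
    have ha : a ∉ b :: t := (List.nodup_cons.1 h).1
    have hτa : (b :: t).formPerm a = a := List.formPerm_apply_of_notMem ha
    have ih' := ih b (List.nodup_cons.1 h).2
    have hx : (b :: t).getLast (List.cons_ne_nil _ _) ∈ b :: t := List.getLast_mem _
    have hτx : (b :: t).formPerm ((b :: t).getLast (List.cons_ne_nil _ _)) = b :=
      List.formPerm_apply_getLast b t
    rw [List.getLast_cons (List.cons_ne_nil b t)]
    generalize hxe : (b :: t).getLast (List.cons_ne_nil _ _) = x at *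
    have hax : a ≠ x := fun e => ha (e ▸ hx)
    have key : ∀ v, c ((a :: b :: t).formPerm v) v = c ((b :: t).formPerm v) v +
        (if v = a then c b a else 0) + (if v = x then c a x - c b x else 0) := by
      intro v
      rw [formPerm_cons_cons_apply h, hxe]
      by_cases h1 : v = a
      · subst h1
        simp [hax, hτa, hc]
      · by_cases h2 : v = x
        · subst h2
          simp [h1, hτx]
        · simp [h1, h2]
    simp only [key, Finset.sum_add_distrib, ih', Finset.sum_ite_eq', Finset.mem_univ, if_true,
      walkCost]
    ring

theorem formPerm_arc (A : V → V → Prop) (l : List V) (a : V) (h : (a :: l).Nodup)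
    (hl : (a :: l).IsChain fun x y => A y x) (v : V) (hv : (a :: l).formPerm v ≠ v) :
    A ((a :: l).formPerm v) v ∨
      (v = (a :: l).getLast (List.cons_ne_nil _ _) ∧ (a :: l).formPerm v = a) := by
  induction l generalizing a with
  | nil => simp at hv
  | cons b t ih =>
    rw [List.isChain_cons_cons] at hl
    rw [formPerm_cons_cons_apply h] at hv ⊢
    rw [List.getLast_cons (List.cons_ne_nil b t)]
    split_ifs at hv ⊢ with h1 h2
    · exact Or.inl (h1 ▸ hl.1)
    · exact Or.inr ⟨h2, rfl⟩
    · exact Or.inl ((ih b (List.nodup_cons.1 h).2 hl.2 hv).resolve_right fun e => h2 e.1)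

/-- A finite digraph in which no permutation moving vertices along arcs has negative cost admits
a feasible potential. -/
theorem exists_potential [Fintype V] (A : V → V → Prop) (c : V → V → ℝ) (hc : ∀ v, c v v = 0)
    (h : ∀ σ : Equiv.Perm V, (∀ v, σ v ≠ v → A (σ v) v) → 0 ≤ ∑ v, c (σ v) v) :
    ∃ z : V → ℝ, ∀ u v, A u v → z v ≤ z u + c u v := by
  have hmin : ∀ v, ∃ t : List V, ((v :: t).Nodup ∧ (v :: t).IsChain fun x y => A y x) ∧
      ∀ t', (v :: t').Nodup ∧ (v :: t').IsChain (fun x y => A y x) →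
        walkCost c (v :: t) ≤ walkCost c (v :: t') := by
    intro v
    have hfin : {t : List V | (v :: t).Nodup ∧ (v :: t).IsChain fun x y => A y x}.Finite := by
      have : {l : List V | l.Nodup}.Finite :=
        Set.finite_coe_iff.1 (inferInstanceAs (Finite {l : List V // l.Nodup}))
      refine (this.preimage (f := List.cons v) (List.cons_injective.injOn)).subset ?_
      intro t ht
      exact ht.1
    obtain ⟨t, ht, hmin⟩ := Set.exists_min_image _ (fun t => walkCost c (v :: t)) hfin
      ⟨[], by simp⟩
    exact ⟨t, ht, hmin⟩
  choose t ht hmin using hmin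
  -- The potential of `v` is the least cost of a simple walk ending at `v`, from any starting
  -- vertex.
  refine ⟨fun v => walkCost c (v :: t v), fun u v huv => ?_⟩
  by_cases hne : v = u
  · subst hne
    simp [hc]
  obtain ⟨hnd, hch⟩ := ht u
  -- If the optimal walk to `u` passes through `v`, its part from `v` to `u` closes up with the arc
  -- from `u` to `v` to a cycle of nonnegative cost, and the part up to `v` competes with `t v`.
  -- Otherwise the walk to `u` extends to `v`.
  by_cases hv : v ∈ t u
  · obtain ⟨s, r, hsr⟩ := List.append_of_mem hv
    have hl : u :: t u = (u :: s) ++ v :: r := by rw [hsr]; rfl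
    have hl2 : u :: t u = (u :: (s ++ [v])) ++ r := by rw [hsr]; simp
    have hsuf : (v :: r) <:+ u :: t u := ⟨u :: s, hl.symm⟩
    have hpre : (u :: (s ++ [v])) <+: u :: t u := ⟨r, hl2.symm⟩
    have h1 := hmin v r ⟨hnd.sublist hsuf.sublist, hch.suffix hsuf⟩
    have hndp := hnd.sublist hpre.sublist
    have h2 := h (u :: (s ++ [v])).formPerm (fun x hx => by
      rcases formPerm_arc A _ _ hndp (hch.prefix hpre) x hx with h3 | ⟨h3, h4⟩
      · exact h3
      · rw [h4, h3]
        simpa using huv)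
    rw [sum_formPerm c hc _ _ hndp] at h2
    have h3 : walkCost c (u :: t u) = walkCost c (u :: (s ++ [v])) + walkCost c (v :: r) := by
      rw [hl, walkCost_append]; rfl
    have h4 : (u :: (s ++ [v])).getLast (List.cons_ne_nil _ _) = v := by simp
    rw [h4] at h2
    show walkCost c (v :: t v) ≤ walkCost c (u :: t u) + c u v
    linarith
  · have h1 := hmin v (u :: t u) ⟨List.nodup_cons.2 ⟨by simp [hne, hv], hnd⟩,
      List.isChain_cons_cons.2 ⟨huv, hch⟩⟩
    simp only [walkCost] at h1 ⊢
    linarith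

end Potential

namespace MPAInstance

variable {N : Type*} [Fintype N]

/-! ### Utilities and blocking pairs in real numbers -/

section Basic

theorem mem_partners {M : Finset (Sym2 N)} {i j : N} : j ∈ partners M i ↔ s(i, j) ∈ M := by
  simp [partners]

theorem IsBMatching.adj {Γ : MPAInstance N} {M : Finset (Sym2 N)} (hM : Γ.IsBMatching M)
    {i j : N} (h : s(i, j) ∈ M) : Γ.G.Adj i j := hM.1 _ h

theorem IsBMatching.cap_ne_zero {Γ : MPAInstance N} {M : Finset (Sym2 N)} (hM : Γ.IsBMatching M)
    {i j : N} (h : s(i, j) ∈ M) : Γ.b i ≠ 0 := by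
  intro h0
  have := hM.2 i
  rw [h0, Nat.le_zero, Finset.card_eq_zero] at this
  exact absurd (mem_partners.2 h) (by simp [this])

omit [Fintype N] in
theorem adj_sides (Γ : MPAInstance N) {i j : N} (h : Γ.G.Adj i j) :
    (i ∈ Γ.I ∧ j ∈ Γ.J) ∨ (i ∈ Γ.J ∧ j ∈ Γ.I) := Γ.bipartite.mem_of_adj h

omit [Fintype N] in
theorem mem_I_or_J (Γ : MPAInstance N) (i : N) : i ∈ Γ.I ∨ i ∈ Γ.J := by
  have : i ∈ Γ.I ∪ Γ.J := by rw [Γ.cover]; trivial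
  exact this

omit [Fintype N] in
theorem notMem_I_of_mem_J (Γ : MPAInstance N) {i : N} (h : i ∈ Γ.J) : i ∉ Γ.I :=
  fun h' => Set.disjoint_left.1 Γ.bipartite.disjoint h' h

theorem utility_eq_top (Γ : MPAInstance N) {M : Finset (Sym2 N)} (hM : Γ.IsBMatching M)
    (p : N → N → ℝ) {i : N} (hb : Γ.b i = 0) : Γ.utility M p i = ⊤ := by
  have h := hM.2 i
  rw [hb, Nat.le_zero] at h
  have h' := Finset.card_eq_zero.1 h
  rw [utility, if_pos (by rw [h, hb]), h', Finset.inf_empty]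

theorem utility_of_not_saturated (Γ : MPAInstance N) {M : Finset (Sym2 N)} (p : N → N → ℝ) {i : N}
    (h : (partners M i).card ≠ Γ.b i) : Γ.utility M p i = 0 := if_neg h

theorem exists_utility_eq (Γ : MPAInstance N) {M : Finset (Sym2 N)} (p : N → N → ℝ) {i : N}
    (hb : Γ.b i ≠ 0) (h : (partners M i).card = Γ.b i) :
    ∃ j, s(i, j) ∈ M ∧ Γ.utility M p i = (p i j : ℝ) ∧ ∀ k, s(i, k) ∈ M → p i j ≤ p i k := by
  obtain ⟨j, hj, hmin⟩ := Finset.exists_min_image (partners M i) (p i)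
    (Finset.card_ne_zero.1 (h ▸ hb))
  refine ⟨j, mem_partners.1 hj, ?_, fun k hk => hmin k (mem_partners.2 hk)⟩
  rw [utility, if_pos h]
  refine le_antisymm (Finset.inf_le hj) (Finset.le_inf fun k hk => ?_)
  exact_mod_cast hmin k hk

/-- The utility of a player as a real number, `0` for the players of capacity `0`. -/
noncomputable def realUtility (Γ : MPAInstance N) (M : Finset (Sym2 N)) (p : N → N → ℝ) (i : N) :
    ℝ :=
  (Γ.utility M p i).untopD 0

theorem utility_eq_coe (Γ : MPAInstance N) (M : Finset (Sym2 N)) (p : N → N → ℝ) {i : N}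
    (hb : Γ.b i ≠ 0) : Γ.utility M p i = (Γ.realUtility M p i : ℝ) := by
  by_cases h : (partners M i).card = Γ.b i
  · obtain ⟨j, -, hj, -⟩ := Γ.exists_utility_eq p hb h
    simp [realUtility, hj]
  · simp [realUtility, Γ.utility_of_not_saturated p h]

theorem realUtility_of_not_saturated (Γ : MPAInstance N) {M : Finset (Sym2 N)} (p : N → N → ℝ)
    {i : N} (h : (partners M i).card ≠ Γ.b i) : Γ.realUtility M p i = 0 := by
  simp [realUtility, Γ.utility_of_not_saturated p h]

theorem exists_realUtility_eq (Γ : MPAInstance N) {M : Finset (Sym2 N)} (p : N → N → ℝ) {i : N}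
    (hb : Γ.b i ≠ 0) (h : (partners M i).card = Γ.b i) :
    ∃ j, s(i, j) ∈ M ∧ Γ.realUtility M p i = p i j := by
  obtain ⟨j, h1, h2, -⟩ := Γ.exists_utility_eq p hb h
  exact ⟨j, h1, by simp [realUtility, h2]⟩

theorem realUtility_nonneg (Γ : MPAInstance N) {M : Finset (Sym2 N)} (hM : Γ.IsBMatching M)
    {p : N → N → ℝ} (hp : Γ.IsPayoff M p) (i : N) : 0 ≤ Γ.realUtility M p i := by
  by_cases hb : Γ.b i = 0
  · simp [realUtility, Γ.utility_eq_top hM p hb]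
  by_cases h : (partners M i).card = Γ.b i
  · obtain ⟨j, -, hj⟩ := Γ.exists_realUtility_eq p hb h
    rw [hj]; exact hp.1 i j
  · rw [Γ.realUtility_of_not_saturated p h]

theorem realUtility_le (Γ : MPAInstance N) {M : Finset (Sym2 N)} (hM : Γ.IsBMatching M)
    {p : N → N → ℝ} (hp : Γ.IsPayoff M p) {i j : N} (hij : s(i, j) ∈ M) :
    Γ.realUtility M p i ≤ p i j := by
  by_cases h : (partners M i).card = Γ.b i
  · obtain ⟨k, -, hk, hmin⟩ := Γ.exists_utility_eq p (hM.cap_ne_zero hij) h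
    simpa [realUtility, hk] using hmin j hij
  · rw [Γ.realUtility_of_not_saturated p h]
    exact hp.1 i j

theorem IsStable.le_add {Γ : MPAInstance N} {M : Finset (Sym2 N)} {p : N → N → ℝ}
    (hs : Γ.IsStable M p) {i j : N} (hij : Γ.G.Adj i j) (h : s(i, j) ∉ M) (hi : Γ.b i ≠ 0)
    (hj : Γ.b j ≠ 0) : Γ.w s(i, j) ≤ Γ.realUtility M p i + Γ.realUtility M p j := by
  by_contra hlt
  refine hs.2.2 i j ⟨hij, h, ?_⟩
  rw [Γ.utility_eq_coe M p hi, Γ.utility_eq_coe M p hj]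
  exact_mod_cast not_le.1 hlt

/-- A player of capacity `0` makes the sum of utilities `⊤`, so the real inequality matters only for
positive capacities. -/
theorem not_blocks (Γ : MPAInstance N) {M : Finset (Sym2 N)} (hM : Γ.IsBMatching M)
    {p : N → N → ℝ} {i j : N}
    (h : Γ.G.Adj i j → s(i, j) ∉ M → Γ.b i ≠ 0 → Γ.b j ≠ 0 →
      Γ.w s(i, j) ≤ Γ.realUtility M p i + Γ.realUtility M p j) : ¬ Γ.Blocks M p i j := by
  rintro ⟨h1, h2, h3⟩
  by_cases hi : Γ.b i = 0
  · simp [Γ.utility_eq_top hM p hi] at h3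
  by_cases hj : Γ.b j = 0
  · simp [Γ.utility_eq_top hM p hj] at h3
  rw [Γ.utility_eq_coe M p hi, Γ.utility_eq_coe M p hj] at h3
  have h4 : Γ.realUtility M p i + Γ.realUtility M p j < Γ.w s(i, j) := by exact_mod_cast h3
  exact absurd (h h1 h2 hi hj) (not_le.2 h4)

end Basic

/-! ### Weak duality and complementary slackness -/

section WeakDuality

theorem sum_partners_swap (M : Finset (Sym2 N)) (f : N → N → ℝ) :
    ∑ i, ∑ j ∈ partners M i, f i j = ∑ i, ∑ j ∈ partners M i, f j i :=
  Finset.sum_comm' fun i j => by simp [mem_partners, Sym2.eq_swap (a := j)]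

theorem sum_partners_eq_two_mul {M : Finset (Sym2 N)} (hM : ∀ i, s(i, i) ∉ M) (f : Sym2 N → ℝ) :
    ∑ i, ∑ j ∈ partners M i, f s(i, j) = 2 * ∑ e ∈ M, f e := by
  classical
  rw [Finset.sum_sigma', ← Finset.sum_fiberwise_of_maps_to
    (g := fun x : (_ : N) × N => s(x.1, x.2)) (t := M)
    (fun x hx => mem_partners.1 (Finset.mem_sigma.1 hx).2), Finset.mul_sum]
  refine Finset.sum_congr rfl fun e he => ?_
  induction e with | _ a b =>
  have hab : a ≠ b := by rintro rfl; exact hM _ he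
  have : (Finset.univ.sigma (partners M)).filter (fun x => s(x.1, x.2) = s(a, b)) =
      {⟨a, b⟩, ⟨b, a⟩} := by
    ext ⟨x, y⟩
    simp only [Finset.mem_filter, Finset.mem_sigma, Finset.mem_univ, true_and, mem_partners,
      Finset.mem_insert, Finset.mem_singleton, Sym2.eq_iff, Sigma.mk.injEq, heq_eq_eq]
    constructor
    · exact fun h => h.2
    · rintro (⟨rfl, rfl⟩ | ⟨rfl, rfl⟩)
      · simp [he]
      · exact ⟨by rwa [Sym2.eq_swap], by simp⟩
  rw [this, Finset.sum_pair (by simp [hab])]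
  rw [Sym2.eq_swap (a := b)]; ring

theorem IsBMatching.sum_weight {Γ : MPAInstance N} {M : Finset (Sym2 N)} (hM : Γ.IsBMatching M) :
    ∑ i, ∑ j ∈ partners M i, Γ.w s(i, j) = 2 * ∑ e ∈ M, Γ.w e :=
  sum_partners_eq_two_mul (fun _ h => (hM.adj h).ne rfl) _

open scoped Classical in
/-- What the stable solution `(M, p)` promises to `i` for a partnership with `j`: the payoff if
`i` and `j` are partners, and the utility of `i` otherwise. -/
noncomputable def promise (Γ : MPAInstance N) (M : Finset (Sym2 N)) (p : N → N → ℝ) (i j : N) : ℝ :=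
  if s(i, j) ∈ M then p i j else Γ.realUtility M p i

variable {Γ : MPAInstance N} {M M' : Finset (Sym2 N)} {p : N → N → ℝ}

theorem IsStable.weight_le_promise (hs : Γ.IsStable M p) (hM' : Γ.IsBMatching M') {i j : N}
    (hij : s(i, j) ∈ M') : Γ.w s(i, j) ≤ Γ.promise M p i j + Γ.promise M p j i := by
  have hji : s(j, i) ∈ M' := by rwa [Sym2.eq_swap]
  unfold promise
  rw [Sym2.eq_swap (a := j)]
  split_ifs with h
  · exact (hs.2.1.2.1 i j h).ge
  · exact hs.le_add (hM'.adj hij) h (hM'.cap_ne_zero hij) (hM'.cap_ne_zero hji)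

-- Common partners cancel and each new partner costs one utility. The correction consists of the
-- surplus above utility lost with the dropped partners and the utility of the capacity left unused
-- by `M'`. The count closes because a player unsaturated by `M` has utility `0`.
open scoped Classical in
theorem sum_promise (Γ : MPAInstance N) (M : Finset (Sym2 N)) (p : N → N → ℝ)
    (M' : Finset (Sym2 N)) (i : N) :
    ∑ j ∈ partners M' i, Γ.promise M p i j +
      (∑ j ∈ partners M i \ partners M' i, (p i j - Γ.realUtility M p i) +
        ((Γ.b i : ℝ) - (partners M' i).card) * Γ.realUtility M p i) =
      ∑ j ∈ partners M i, p i j := by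
  have h0 : ((Γ.b i : ℝ) - (partners M i).card) * Γ.realUtility M p i = 0 := by
    by_cases h : (partners M i).card = Γ.b i
    · rw [h, sub_self, zero_mul]
    · rw [Γ.realUtility_of_not_saturated p h, mul_zero]
  have h1 : ∑ j ∈ partners M' i ∩ partners M i, Γ.promise M p i j =
      ∑ j ∈ partners M i ∩ partners M' i, p i j := by
    rw [Finset.inter_comm]
    exact Finset.sum_congr rfl fun j hj =>
      if_pos (mem_partners.1 (Finset.mem_inter.1 hj).1)
  have h2 : ∑ j ∈ partners M' i \ partners M i, Γ.promise M p i j =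
      (partners M' i \ partners M i).card * Γ.realUtility M p i := by
    rw [← nsmul_eq_mul, ← Finset.sum_const]
    exact Finset.sum_congr rfl fun j hj =>
      if_neg fun h => (Finset.mem_sdiff.1 hj).2 (mem_partners.2 h)
  have h3 : ((partners M' i ∩ partners M i).card : ℝ) + (partners M' i \ partners M i).card =
      (partners M' i).card := by
    exact_mod_cast Finset.card_inter_add_card_sdiff _ _
  have h4 : ((partners M' i ∩ partners M i).card : ℝ) + (partners M i \ partners M' i).card =
      (partners M i).card := by
    rw [Finset.inter_comm]
    exact_mod_cast Finset.card_inter_add_card_sdiff _ _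
  rw [← Finset.sum_inter_add_sum_sdiff (partners M' i) (partners M i),
    ← Finset.sum_inter_add_sum_sdiff (partners M i) (partners M' i), h1, h2,
    Finset.sum_sub_distrib, Finset.sum_const, nsmul_eq_mul]
  linear_combination h0 + (h3 - h4) * Γ.realUtility M p i

theorem IsStable.sum_payoff (hs : Γ.IsStable M p) :
    ∑ i, ∑ j ∈ partners M i, p i j = ∑ e ∈ M, Γ.w e := by
  have h1 := sum_partners_swap M p
  have h2 : ∑ i, ∑ j ∈ partners M i, p i j + ∑ i, ∑ j ∈ partners M i, p j i =
      2 * ∑ e ∈ M, Γ.w e := by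
    rw [← hs.1.sum_weight]
    simp_rw [← Finset.sum_add_distrib]
    exact Finset.sum_congr rfl fun i _ => Finset.sum_congr rfl fun j hj =>
      hs.2.1.2.1 i j (mem_partners.1 hj)
  linarith

-- An identity rather than an inequality, so that every slack can be forced to vanish when `M'` has
-- maximum weight. The half is there because each edge of `M'` is counted from both ends.
open scoped Classical in
theorem IsStable.sum_excess (hs : Γ.IsStable M p) (hM' : Γ.IsBMatching M') :
    (∑ e ∈ M', Γ.w e) +
      ((∑ i, ∑ j ∈ partners M' i,
        (Γ.promise M p i j + Γ.promise M p j i - Γ.w s(i, j))) / 2 +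
      ∑ i, (∑ j ∈ partners M i \ partners M' i, (p i j - Γ.realUtility M p i) +
        ((Γ.b i : ℝ) - (partners M' i).card) * Γ.realUtility M p i)) = ∑ e ∈ M, Γ.w e := by
  have h1 := sum_partners_swap M' (Γ.promise M p)
  have h2 := hM'.sum_weight
  have h3 : ∑ i, (∑ j ∈ partners M' i, Γ.promise M p i j +
      (∑ j ∈ partners M i \ partners M' i, (p i j - Γ.realUtility M p i) +
        ((Γ.b i : ℝ) - (partners M' i).card) * Γ.realUtility M p i)) = ∑ e ∈ M, Γ.w e := by
    rw [← hs.sum_payoff]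
    exact Finset.sum_congr rfl fun i _ => Γ.sum_promise M p M' i
  rw [Finset.sum_add_distrib] at h3
  simp_rw [Finset.sum_sub_distrib, Finset.sum_add_distrib] at h3 ⊢
  linarith

theorem IsStable.excess_nonneg (hs : Γ.IsStable M p) (hM' : Γ.IsBMatching M') (i : N) :
    0 ≤ ∑ j ∈ partners M' i, (Γ.promise M p i j + Γ.promise M p j i - Γ.w s(i, j)) :=
  Finset.sum_nonneg fun _ hj => sub_nonneg.2 (hs.weight_le_promise hM' (mem_partners.1 hj))

theorem IsStable.cap_excess_nonneg (hs : Γ.IsStable M p) (hM' : Γ.IsBMatching M') (i : N) :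
    0 ≤ ((Γ.b i : ℝ) - (partners M' i).card) * Γ.realUtility M p i :=
  mul_nonneg (sub_nonneg.2 (by exact_mod_cast hM'.2 i)) (Γ.realUtility_nonneg hs.1 hs.2.1 i)

open scoped Classical in
theorem IsStable.loss_nonneg (hs : Γ.IsStable M p) (i : N) :
    0 ≤ ∑ j ∈ partners M i \ partners M' i, (p i j - Γ.realUtility M p i) :=
  Finset.sum_nonneg fun _ hj => sub_nonneg.2
    (Γ.realUtility_le hs.1 hs.2.1 (mem_partners.1 (Finset.mem_sdiff.1 hj).1))

theorem IsStable.isMaxWeight (hs : Γ.IsStable M p) : Γ.IsMaxWeightBMatching M := by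
  classical
  refine ⟨hs.1, fun M' hM' => ?_⟩
  rw [← hs.sum_excess hM']
  have h1 := Finset.sum_nonneg fun i (_ : i ∈ Finset.univ) => hs.excess_nonneg hM' i
  have h2 := Finset.sum_nonneg fun i (_ : i ∈ Finset.univ) =>
    add_nonneg (hs.loss_nonneg (M' := M') i) (hs.cap_excess_nonneg hM' i)
  linarith

/-- Complementary slackness for a stable solution and a matching of maximum weight. -/
theorem IsStable.slackness (hs : Γ.IsStable M p) (hM' : Γ.IsMaxWeightBMatching M') :
    (∀ i j, s(i, j) ∈ M' → Γ.promise M p i j + Γ.promise M p j i = Γ.w s(i, j)) ∧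
    (∀ i j, s(i, j) ∈ M → s(i, j) ∉ M' → p i j = Γ.realUtility M p i) ∧
    (∀ i, (partners M' i).card ≠ Γ.b i → Γ.realUtility M p i = 0) ∧
    (∀ i, ∑ j ∈ partners M' i, Γ.promise M p i j = ∑ j ∈ partners M i, p i j) := by
  classical
  have h0 := hs.sum_excess hM'.1
  have hle := hM'.2 M hs.1
  have h1 := fun i (_ : i ∈ Finset.univ) => hs.excess_nonneg hM'.1 i
  have h2 := fun i (_ : i ∈ Finset.univ) =>
    add_nonneg (hs.loss_nonneg (M' := M') i) (hs.cap_excess_nonneg hM'.1 i)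
  have h1' := Finset.sum_nonneg h1
  have h2' := Finset.sum_nonneg h2
  -- By `hle` the total of the nonnegative slacks is at most `0`.
  have e1 := (Finset.sum_eq_zero_iff_of_nonneg h1).1 (by linarith)
  have e2 := (Finset.sum_eq_zero_iff_of_nonneg h2).1 (by linarith)
  have e3 := fun i => (add_eq_zero_iff_of_nonneg (hs.loss_nonneg (M' := M') i)
    (hs.cap_excess_nonneg hM'.1 i)).1 (e2 i (Finset.mem_univ i))
  refine ⟨fun i j hij => ?_, fun i j h h' => ?_, fun i hi => ?_, fun i => ?_⟩
  · have := (Finset.sum_eq_zero_iff_of_nonneg fun j hj => sub_nonneg.2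
      (hs.weight_le_promise hM'.1 (mem_partners.1 hj))).1 (e1 i (Finset.mem_univ i)) j
        (mem_partners.2 hij)
    linarith
  · have := (Finset.sum_eq_zero_iff_of_nonneg fun j hj => sub_nonneg.2
      (Γ.realUtility_le hs.1 hs.2.1 (mem_partners.1 (Finset.mem_sdiff.1 hj).1))).1 (e3 i).1 j
        (Finset.mem_sdiff.2 ⟨mem_partners.2 h, fun h'' => h' (mem_partners.1 h'')⟩)
    linarith
  · refine (mul_eq_zero.1 (e3 i).2).resolve_left fun h => hi ?_
    exact_mod_cast (sub_eq_zero.1 h).symm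
  · rw [← Γ.sum_promise M p M' i, e2 i (Finset.mem_univ i), add_zero]

end WeakDuality

/-! ### Moving stable payoffs between maximum weight matchings -/

section Transfer

variable {Γ : MPAInstance N}

open scoped Classical in
/-- The payoff vector on `M'` equivalent to the stable solution `(M, p)`. -/
noncomputable def transferPayoff (Γ : MPAInstance N) (M : Finset (Sym2 N)) (p : N → N → ℝ)
    (M' : Finset (Sym2 N)) (i j : N) : ℝ :=
  if s(i, j) ∈ M' then Γ.promise M p i j else 0

variable {M M' : Finset (Sym2 N)} {p : N → N → ℝ}

theorem IsStable.promise_nonneg (hs : Γ.IsStable M p) (i j : N) : 0 ≤ Γ.promise M p i j := by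
  unfold promise
  split_ifs
  · exact hs.2.1.1 i j
  · exact Γ.realUtility_nonneg hs.1 hs.2.1 i

theorem IsStable.realUtility_le_promise (hs : Γ.IsStable M p) (i j : N) :
    Γ.realUtility M p i ≤ Γ.promise M p i j := by
  unfold promise
  split_ifs with h
  · exact Γ.realUtility_le hs.1 hs.2.1 h
  · exact le_rfl

theorem IsStable.isPayoff_transferPayoff (hs : Γ.IsStable M p)
    (hM' : Γ.IsMaxWeightBMatching M') : Γ.IsPayoff M' (Γ.transferPayoff M p M') := by
  refine ⟨fun i j => ?_, fun i j h => ?_, fun i j h => if_neg h⟩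
  · unfold transferPayoff
    split_ifs
    · exact hs.promise_nonneg i j
    · exact le_rfl
  · rw [transferPayoff, transferPayoff, if_pos h, if_pos (by rwa [Sym2.eq_swap])]
    exact (hs.slackness hM').1 i j h

/-- No promise is below the utility, and a player saturated by `M'` has a partner who pays exactly
that: any new partner does, and without new partners the sets of partners coincide by cardinality.
For an unsaturated player, slackness makes the old utility `0`. -/
theorem IsStable.realUtility_transferPayoff (hs : Γ.IsStable M p)
    (hM' : Γ.IsMaxWeightBMatching M') {i : N} (hb : Γ.b i ≠ 0) :
    Γ.realUtility M' (Γ.transferPayoff M p M') i = Γ.realUtility M p i := by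
  by_cases h : (partners M' i).card = Γ.b i
  · apply le_antisymm
    · have hex : ∃ j, s(i, j) ∈ M' ∧ Γ.promise M p i j = Γ.realUtility M p i := by
        by_cases hsub : partners M' i ⊆ partners M i
        · have heq : partners M' i = partners M i :=
            Finset.eq_of_subset_of_card_le hsub (h ▸ hs.1.2 i)
          obtain ⟨j, hj, e⟩ := Γ.exists_realUtility_eq p hb (heq ▸ h)
          exact ⟨j, mem_partners.1 (heq ▸ mem_partners.2 hj), by rw [e]; exact if_pos hj⟩
        · obtain ⟨j, hj, hj'⟩ := Finset.not_subset.1 hsub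
          exact ⟨j, mem_partners.1 hj, if_neg fun h => hj' (mem_partners.2 h)⟩
      obtain ⟨j, hj, e⟩ := hex
      have := Γ.realUtility_le hM'.1 (hs.isPayoff_transferPayoff hM') hj
      rwa [transferPayoff, if_pos hj, e] at this
    · obtain ⟨j, hj, e⟩ := Γ.exists_realUtility_eq (Γ.transferPayoff M p M') hb h
      rw [e, transferPayoff, if_pos hj]
      exact hs.realUtility_le_promise i j
  · rw [Γ.realUtility_of_not_saturated _ h, (hs.slackness hM').2.2.1 i h]

theorem IsStable.transfer (hs : Γ.IsStable M p) (hM' : Γ.IsMaxWeightBMatching M') :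
    Γ.IsStable M' (Γ.transferPayoff M p M') := by
  refine ⟨hM'.1, hs.isPayoff_transferPayoff hM', fun i j => Γ.not_blocks hM'.1 ?_⟩
  intro hij h hi hj
  rw [hs.realUtility_transferPayoff hM' hi, hs.realUtility_transferPayoff hM' hj]
  -- For a pair of `M` dropped by `M'`, slackness says that both players received exactly their
  -- utilities, which therefore add up to the weight.
  by_cases h' : s(i, j) ∈ M
  · have hji : s(j, i) ∈ M := by rwa [Sym2.eq_swap]
    rw [← hs.2.1.2.1 i j h', (hs.slackness hM').2.1 i j h' h,
      (hs.slackness hM').2.1 j i hji (by rwa [Sym2.eq_swap])]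
  · exact hs.le_add hij h' hi hj

/-- The stable solution on `M'` with a payoff vector equivalent to that of `t`. -/
noncomputable def StableSolution.transfer (t : Γ.StableSolution) {M' : Finset (Sym2 N)}
    (hM' : Γ.IsMaxWeightBMatching M') : Γ.StableSolution :=
  ⟨M', _, t.stable.transfer hM'⟩

theorem StableSolution.equivalent_transfer (t : Γ.StableSolution)
    (hM' : Γ.IsMaxWeightBMatching M') : Γ.Equivalent (t.transfer hM') t := by
  have hu : ∀ i, Γ.utility M' (Γ.transferPayoff t.matching t.payoff M') i =
      Γ.utility t.matching t.payoff i := by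
    intro i
    by_cases hb : Γ.b i = 0
    · rw [Γ.utility_eq_top hM'.1 _ hb, Γ.utility_eq_top t.stable.1 _ hb]
    · rw [Γ.utility_eq_coe _ _ hb, Γ.utility_eq_coe _ _ hb,
        t.stable.realUtility_transferPayoff hM' hb]
  refine ⟨hu, fun i j h h' => ?_, fun i j h h' => ?_, fun i j h h' => ?_⟩
  · show Γ.transferPayoff t.matching t.payoff M' i j = _
    exact (if_pos h).trans (if_pos h')
  · show ((Γ.transferPayoff t.matching t.payoff M' i j : ℝ) : WithTop ℝ) =
      Γ.utility M' (Γ.transferPayoff t.matching t.payoff M') i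
    rw [hu, Γ.utility_eq_coe _ _ (hM'.1.cap_ne_zero h)]
    exact congrArg _ ((if_pos h).trans (if_neg h'))
  · rw [Γ.utility_eq_coe _ _ (t.stable.1.cap_ne_zero h),
      (t.stable.slackness hM').2.1 i j h h']

theorem Equivalent.eq_of_matching_eq {s t : Γ.StableSolution} (h : Γ.Equivalent s t)
    (hm : s.matching = t.matching) : s = t := by
  refine StableSolution.ext hm (funext₂ fun i j => ?_)
  by_cases hij : s(i, j) ∈ s.matching
  · exact h.2.1 i j hij (hm ▸ hij)
  · rw [s.stable.2.1.2.2 i j hij, t.stable.2.1.2.2 i j (hm ▸ hij)]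

theorem StableSolution.toPayoff_eq_iff {s t : Γ.StableSolution} :
    s.toPayoff = t.toPayoff ↔ Γ.Equivalent s t :=
  ⟨fun h => Quotient.exact h, fun h => Quotient.sound h⟩

theorem StableSolution.isMaxWeight (s : Γ.StableSolution) : Γ.IsMaxWeightBMatching s.matching :=
  s.stable.isMaxWeight

theorem existsUnique_toPayoff_eq (hM' : Γ.IsMaxWeightBMatching M') (x : Γ.StablePayoff) :
    ∃! s : Γ.StableSolution, s.matching = M' ∧ s.toPayoff = x := by
  induction x using Quotient.inductionOn with | _ t =>
  refine ⟨t.transfer hM', ⟨rfl, StableSolution.toPayoff_eq_iff.2 (t.equivalent_transfer hM')⟩, ?_⟩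
  rintro s ⟨hs, hs'⟩
  have h1 : Γ.Equivalent s t := StableSolution.toPayoff_eq_iff.1 hs'
  exact ((Equivalent.isEquivalence Γ).trans h1 ((Equivalent.isEquivalence Γ).symm
    (t.equivalent_transfer hM'))).eq_of_matching_eq hs

theorem StableSolution.totalPayoff_eq (s : Γ.StableSolution) (i : N) :
    Γ.totalPayoff s.payoff i = ∑ j ∈ partners s.matching i, s.payoff i j := by
  symm
  refine Finset.sum_subset (fun j hj => ?_) fun j _ hj => ?_
  · simpa using s.stable.1.adj (mem_partners.1 hj)
  · exact s.stable.2.1.2.2 i j fun h => hj (mem_partners.2 h)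

/-- By the last clause of slackness, the promises along the other matching have the same sum. This
makes optimality a property of the class. -/
theorem Equivalent.totalPayoff_eq {s t : Γ.StableSolution} (h : Γ.Equivalent s t) (i : N) :
    Γ.totalPayoff s.payoff i = Γ.totalPayoff t.payoff i := by
  have hs : s = t.transfer s.isMaxWeight :=
    ((Equivalent.isEquivalence Γ).trans h ((Equivalent.isEquivalence Γ).symm
      (t.equivalent_transfer s.isMaxWeight))).eq_of_matching_eq rfl
  rw [s.totalPayoff_eq, t.totalPayoff_eq, ← (t.stable.slackness s.isMaxWeight).2.2.2 i]
  refine Finset.sum_congr rfl fun j hj => ?_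
  rw [congrArg (fun r => r.payoff i j) hs]
  exact if_pos (mem_partners.1 hj)

end Transfer

end MPAInstance

namespace MPAInstance

variable {N : Type*} [Fintype N]

/-! ### Strong duality and existence of stable solutions -/

section StrongDuality

theorem exists_isMaxWeightBMatching (Γ : MPAInstance N) : ∃ M, Γ.IsMaxWeightBMatching M := by
  obtain ⟨M, hM, hmax⟩ := Set.exists_max_image {M | Γ.IsBMatching M} (fun M => ∑ e ∈ M, Γ.w e)
    (Set.toFinite _) ⟨∅, by simp, fun i => by simp [partners]⟩
  exact ⟨M, hM, hmax⟩

/-- The arcs of the residual digraph of `M`; the vertex `none` stands for free capacity. -/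
def ResidualArc (Γ : MPAInstance N) (M : Finset (Sym2 N)) : Option N → Option N → Prop
  | some i, some j => (i ∈ Γ.I ∧ Γ.G.Adj i j ∧ s(i, j) ∉ M) ∨ (i ∈ Γ.J ∧ s(i, j) ∈ M)
  -- Between players, an arc into a seller deletes an edge and an arc out of a seller adds one; for
  -- buyers it is the reverse. So a walk may always end at a seller or start at a buyer, while the
  -- other ends consume capacity.
  | some i, none => i ∈ Γ.I ∨ (partners M i).card < Γ.b i
  | none, some i => i ∈ Γ.J ∨ (partners M i).card < Γ.b i
  | none, none => False

open scoped Classical in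
/-- The loss of weight when the edge `e` is added to or removed from `M`. -/
noncomputable def exchangeCost (Γ : MPAInstance N) (M : Finset (Sym2 N)) (e : Sym2 N) : ℝ :=
  if e ∈ M then Γ.w e else -Γ.w e

open scoped Classical in
/-- The costs of the residual arcs. -/
noncomputable def residualCost (Γ : MPAInstance N) (M : Finset (Sym2 N)) : Option N → Option N → ℝ
  | some i, some j => if i = j then 0 else Γ.exchangeCost M s(i, j)
  | _, _ => 0

omit [Fintype N] in
theorem residualCost_self (Γ : MPAInstance N) (M : Finset (Sym2 N)) (v : Option N) :
    Γ.residualCost M v v = 0 := by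
  cases v <;> simp [residualCost]

open scoped Classical in
/-- The edges used by a permutation of the vertices of the residual digraph. -/
noncomputable def permEdges (σ : Equiv.Perm (Option N)) : Finset (Sym2 N) :=
  (Finset.univ.filter fun j => ∃ i, i ≠ j ∧ σ (some j) = some i).image
    fun j => s((σ (some j)).getD j, j)

theorem mem_permEdges {σ : Equiv.Perm (Option N)} {i j : N} :
    s(i, j) ∈ permEdges σ ↔ i ≠ j ∧ (σ (some j) = some i ∨ σ (some i) = some j) := by
  simp only [permEdges, Finset.mem_image, Finset.mem_filter, Finset.mem_univ, true_and,
    Sym2.eq_iff]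
  constructor
  · rintro ⟨k, ⟨l, hl, h⟩, ⟨h1, h2⟩ | ⟨h1, h2⟩⟩
    · subst h2
      rw [h] at h1
      subst h1
      exact ⟨hl, Or.inl h⟩
    · subst h2
      rw [h] at h1
      subst h1
      exact ⟨hl.symm, Or.inr h⟩
  · rintro ⟨hne, h | h⟩
    · exact ⟨j, ⟨i, hne, h⟩, Or.inl ⟨by simp [h], rfl⟩⟩
    · exact ⟨i, ⟨j, hne.symm, h⟩, Or.inr ⟨by simp [h], rfl⟩⟩

variable {Γ : MPAInstance N} {M : Finset (Sym2 N)} {σ : Equiv.Perm (Option N)}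

omit [Fintype N] in
theorem mem_J_of_adj {i j : N} (hi : i ∈ Γ.I) (h : Γ.G.Adj i j) : j ∈ Γ.J :=
  ((Γ.adj_sides h).resolve_right fun h' => Γ.notMem_I_of_mem_J h'.1 hi).2

omit [Fintype N] in
theorem mem_I_of_adj {i j : N} (hi : i ∈ Γ.J) (h : Γ.G.Adj i j) : j ∈ Γ.I :=
  ((Γ.adj_sides h).resolve_left fun h' => Γ.notMem_I_of_mem_J hi h'.1).2

/-- Excludes 2-cycles of players, so that distinct arcs of a permutation use distinct edges. -/
theorem ResidualArc.not_symm (hM : Γ.IsBMatching M) {i j : N}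
    (h : Γ.ResidualArc M (some i) (some j)) : ¬ Γ.ResidualArc M (some j) (some i) := by
  rcases h with ⟨h1, h2, h3⟩ | ⟨h1, h2⟩
  · rintro (⟨h4, -⟩ | ⟨-, h5⟩)
    · exact Γ.notMem_I_of_mem_J (mem_J_of_adj h1 h2) h4
    · exact h3 (by rwa [Sym2.eq_swap])
  · rintro (⟨-, -, h5⟩ | ⟨h4, -⟩)
    · exact h5 (by rwa [Sym2.eq_swap])
    · exact Γ.notMem_I_of_mem_J h4 (mem_I_of_adj h1 (hM.adj h2))

theorem sum_residualCost (hM : Γ.IsBMatching M)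
    (hσ : ∀ v, σ v ≠ v → Γ.ResidualArc M (σ v) v) :
    ∑ v, Γ.residualCost M (σ v) v = ∑ e ∈ permEdges σ, Γ.exchangeCost M e := by
  classical
  rw [permEdges, Finset.sum_image, Fintype.sum_option]
  · have h0 : Γ.residualCost M (σ none) none = 0 := by
      cases σ none <;> rfl
    rw [h0, zero_add, Finset.sum_filter]
    refine Finset.sum_congr rfl fun j _ => ?_
    cases h : σ (some j) with
    | none => simp [residualCost]
    | some i => by_cases hij : i = j <;> simp [residualCost, hij]
  · intro j hj j' hj' e
    simp only [Finset.coe_filter, Finset.mem_univ, true_and, Set.mem_ofPred_eq] at hj hj'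
    obtain ⟨i, hi, h⟩ := hj
    obtain ⟨i', hi', h'⟩ := hj'
    simp only [h, h', Option.getD_some, Sym2.eq_iff] at e
    rcases e with e | ⟨rfl, rfl⟩
    · exact e.2
    · have a1 := hσ (some j) (by rw [h]; simpa using hi)
      have a2 := hσ (some i) (by rw [h']; simpa using hi')
      rw [h] at a1
      rw [h'] at a2
      exact absurd a2 (a1.not_symm hM)

omit [Fintype N] in
open scoped Classical in
theorem sum_symmDiff_weight (M T : Finset (Sym2 N)) :
    ∑ e ∈ symmDiff M T, Γ.w e = ∑ e ∈ M, Γ.w e - ∑ e ∈ T, Γ.exchangeCost M e := by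
  have h1 : ∑ e ∈ T ∩ M, Γ.exchangeCost M e = ∑ e ∈ M ∩ T, Γ.w e := by
    rw [Finset.inter_comm]
    exact Finset.sum_congr rfl fun e he => if_pos (Finset.mem_inter.1 he).1
  have h2 : ∑ e ∈ T \ M, Γ.exchangeCost M e = - ∑ e ∈ T \ M, Γ.w e := by
    rw [← Finset.sum_neg_distrib]
    exact Finset.sum_congr rfl fun e he => if_neg (Finset.mem_sdiff.1 he).2
  rw [← Finset.sum_inter_add_sum_sdiff T M, ← Finset.sum_inter_add_sum_sdiff M T Γ.w, h1, h2,
    symmDiff_def, Finset.sup_eq_union, Finset.sum_union disjoint_sdiff_sdiff]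
  ring

/-- At most one element is gained, and it is paid for by free capacity or by a lost element. -/
theorem card_le_of_exchange {α : Type*} [DecidableEq α] {A B : Finset α} {n : ℕ}
    (hB : B.card ≤ n) (h1 : ∀ k ∈ A \ B, ∀ k' ∈ A \ B, k = k')
    (h2 : (A \ B).Nonempty → B.card < n ∨ (B \ A).Nonempty) : A.card ≤ n := by
  have e1 := Finset.card_inter_add_card_sdiff A B
  have e2 := Finset.card_inter_add_card_sdiff B A
  rw [Finset.inter_comm] at e2
  rcases (A \ B).eq_empty_or_nonempty with h | h
  · rw [h, Finset.card_empty] at e1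
    omega
  · have e3 : (A \ B).card ≤ 1 := Finset.card_le_one.2 h1
    rcases h2 h with h3 | h3
    · omega
    · have := h3.card_pos
      omega

open scoped Classical in
theorem mem_symmDiff_permEdges {i j : N} :
    s(i, j) ∈ symmDiff M (permEdges σ) ↔ (s(i, j) ∈ M ∧ s(i, j) ∉ permEdges σ) ∨
      (s(i, j) ∈ permEdges σ ∧ s(i, j) ∉ M) := Finset.mem_symmDiff

-- A permutation uses at most one arc into and one arc out of each player. A seller gains an edge
-- only through the outgoing arc; the incoming arc then deletes an edge or comes from `none`, which
-- certifies free capacity. For buyers the two arcs exchange roles.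
open scoped Classical in
theorem isBMatching_symmDiff (hM : Γ.IsBMatching M)
    (hσ : ∀ v, σ v ≠ v → Γ.ResidualArc M (σ v) v) :
    Γ.IsBMatching (symmDiff M (permEdges σ)) := by
  have harc : ∀ i j, i ≠ j → σ (some j) = some i → Γ.ResidualArc M (some i) (some j) := by
    intro i j hij h
    have := hσ (some j) (by rw [h]; simpa using hij)
    rwa [h] at this
  have hnew : ∀ i j, s(i, j) ∈ permEdges σ → s(i, j) ∉ M →
      (i ∈ Γ.I ∧ Γ.G.Adj i j ∧ σ (some j) = some i) ∨
      (i ∈ Γ.J ∧ Γ.G.Adj i j ∧ σ (some i) = some j) := by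
    intro i j h hij
    obtain ⟨hne, h | h⟩ := mem_permEdges.1 h
    · rcases harc i j hne h with h1 | h1
      · exact Or.inl ⟨h1.1, h1.2.1, h⟩
      · exact absurd h1.2 hij
    · rcases harc j i hne.symm h with h1 | h1
      · exact Or.inr ⟨mem_J_of_adj h1.1 h1.2.1, h1.2.1.symm, h⟩
      · exact absurd h1.2 (by rwa [Sym2.eq_swap])
  refine ⟨fun e he => ?_, fun i => ?_⟩
  · induction e with | _ i j =>
    rcases mem_symmDiff_permEdges.1 he with h | h
    · exact hM.adj h.1
    · rcases hnew i j h.1 h.2 with h1 | h1 <;> exact h1.2.1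
  · have hdiff : ∀ k, k ∈ partners (symmDiff M (permEdges σ)) i \ partners M i ↔
        s(i, k) ∈ permEdges σ ∧ s(i, k) ∉ M := by
      intro k
      rw [Finset.mem_sdiff, mem_partners, mem_partners, mem_symmDiff_permEdges]
      tauto
    have hdiff' : ∀ k, k ∈ partners M i \ partners (symmDiff M (permEdges σ)) i ↔
        s(i, k) ∈ permEdges σ ∧ s(i, k) ∈ M := by
      intro k
      rw [Finset.mem_sdiff, mem_partners, mem_partners, mem_symmDiff_permEdges]
      tauto
    rcases Γ.mem_I_or_J i with hi | hi
    · have hk : ∀ k, s(i, k) ∈ permEdges σ → s(i, k) ∉ M →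
          Γ.G.Adj i k ∧ σ (some k) = some i := fun k h h' =>
        ((hnew i k h h').resolve_right fun h1 => Γ.notMem_I_of_mem_J h1.1 hi).2
      refine card_le_of_exchange (hM.2 i) (fun k h k' h' => ?_) ?_
      · rw [hdiff] at h h'
        simpa using σ.injective ((hk k h.1 h.2).2.trans (hk k' h'.1 h'.2).2.symm)
      · rintro ⟨k, h⟩
        rw [hdiff] at h
        obtain ⟨ha, hkσ⟩ := hk k h.1 h.2
        have hmv : σ (some i) ≠ some i := fun h1 =>
          ha.ne (by simpa using σ.injective (h1.trans hkσ.symm))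
        have hr := hσ _ hmv
        cases hj : σ (some i) with
        | none =>
          rw [hj] at hr
          exact Or.inl (hr.resolve_left fun h1 => Γ.notMem_I_of_mem_J h1 hi)
        | some j =>
          rw [hj] at hr hmv
          have hji : j ≠ i := fun h1 => hmv (by rw [h1])
          refine Or.inr ⟨j, (hdiff' j).2 ⟨mem_permEdges.2 ⟨hji.symm, Or.inr hj⟩, ?_⟩⟩
          rcases hr with h1 | h1
          · exact absurd hi (Γ.notMem_I_of_mem_J (mem_J_of_adj h1.1 h1.2.1))
          · rw [Sym2.eq_swap]; exact h1.2
    · have hk : ∀ k, s(i, k) ∈ permEdges σ → s(i, k) ∉ M →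
          Γ.G.Adj i k ∧ σ (some i) = some k := fun k h h' =>
        ((hnew i k h h').resolve_left fun h1 => Γ.notMem_I_of_mem_J hi h1.1).2
      refine card_le_of_exchange (hM.2 i) (fun k h k' h' => ?_) ?_
      · rw [hdiff] at h h'
        simpa using (hk k h.1 h.2).2.symm.trans (hk k' h'.1 h'.2).2
      · rintro ⟨k, h⟩
        rw [hdiff] at h
        obtain ⟨ha, hkσ⟩ := hk k h.1 h.2
        obtain ⟨v, hv⟩ := σ.surjective (some i)
        have hmv : σ v ≠ v := fun h1 => by
          rw [hv] at h1
          rw [← h1, hkσ] at hv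
          exact ha.ne (by simpa using hv.symm)
        have hr := hσ _ hmv
        rw [hv] at hr hmv
        cases v with
        | none => exact Or.inl (hr.resolve_left fun h1 => Γ.notMem_I_of_mem_J hi h1)
        | some j =>
          have hij : i ≠ j := fun h1 => hmv (by rw [h1])
          refine Or.inr ⟨j, (hdiff' j).2 ⟨mem_permEdges.2 ⟨hij, Or.inl hv⟩, ?_⟩⟩
          rcases hr with h1 | h1
          · exact absurd h1.1 (Γ.notMem_I_of_mem_J hi)
          · exact h1.2

/-- A permutation of negative cost would exchange `M` for a heavier `b`-matching. -/
theorem IsMaxWeightBMatching.sum_residualCost_nonneg (hM : Γ.IsMaxWeightBMatching M)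
    (hσ : ∀ v, σ v ≠ v → Γ.ResidualArc M (σ v) v) :
    0 ≤ ∑ v, Γ.residualCost M (σ v) v := by
  classical
  have h := hM.2 _ (isBMatching_symmDiff hM.1 hσ)
  rw [sum_symmDiff_weight] at h
  rw [sum_residualCost hM.1 hσ]
  linarith

/-- Linear programming duality: a matching of maximum weight has an optimal dual solution. -/
theorem IsMaxWeightBMatching.exists_dual (hM : Γ.IsMaxWeightBMatching M) :
    ∃ y : N → ℝ, (∀ i, 0 ≤ y i) ∧ (∀ i, (partners M i).card < Γ.b i → y i = 0) ∧
      (∀ i j, Γ.G.Adj i j → s(i, j) ∉ M → Γ.w s(i, j) ≤ y i + y j) ∧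
      (∀ i j, s(i, j) ∈ M → y i + y j ≤ Γ.w s(i, j)) := by
  classical
  obtain ⟨z, hz⟩ := exists_potential (Γ.ResidualArc M) (Γ.residualCost M) (Γ.residualCost_self M)
    fun σ hσ => hM.sum_residualCost_nonneg hσ
  have hI : ∀ i, i ∈ Γ.I → z none ≤ z (some i) := fun i hi => by
    simpa [residualCost] using hz (some i) none (Or.inl hi)
  have hJ : ∀ i, i ∈ Γ.J → z (some i) ≤ z none := fun i hi => by
    simpa [residualCost] using hz none (some i) (Or.inl hi)
  have hU : ∀ i, (partners M i).card < Γ.b i → z (some i) = z none := fun i hi => by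
    refine le_antisymm ?_ ?_
    · simpa [residualCost] using hz none (some i) (Or.inr hi)
    · simpa [residualCost] using hz (some i) none (Or.inr hi)
  have hE : ∀ i j, i ∈ Γ.I → Γ.G.Adj i j → s(i, j) ∉ M →
      Γ.w s(i, j) ≤ z (some i) - z (some j) := fun i j hi hij h => by
    have := hz (some i) (some j) (Or.inl ⟨hi, hij, h⟩)
    simp only [residualCost, exchangeCost, hij.ne, h, if_false] at this
    linarith
  have hE' : ∀ i j, i ∈ Γ.I → s(i, j) ∈ M → z (some i) - z (some j) ≤ Γ.w s(i, j) :=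
    fun i j hi h => by
      have hij := hM.1.adj h
      have h' : s(j, i) ∈ M := by rwa [Sym2.eq_swap]
      have := hz (some j) (some i) (Or.inr ⟨mem_J_of_adj hi hij, h'⟩)
      simp only [residualCost, exchangeCost, hij.ne.symm, h', if_false, if_true] at this
      rw [Sym2.eq_swap]
      linarith
  -- The dual value is the potential relative to `none`, with opposite signs on the two sides. The
  -- arcs at `none` give the sign, and for unsaturated players, with arcs both ways, the value `0`.
  set y : N → ℝ := fun i => if i ∈ Γ.I then z (some i) - z none else z none - z (some i) with hy
  have hyI : ∀ i, i ∈ Γ.I → y i = z (some i) - z none := fun i hi => if_pos hi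
  have hyJ : ∀ i, i ∈ Γ.J → y i = z none - z (some i) := fun i hi =>
    if_neg (Γ.notMem_I_of_mem_J hi)
  refine ⟨y, fun i => ?_, fun i hi => ?_, fun i j hij h => ?_, fun i j h => ?_⟩
  · rcases Γ.mem_I_or_J i with hi | hi
    · rw [hyI i hi]; linarith [hI i hi]
    · rw [hyJ i hi]; linarith [hJ i hi]
  · simp [hy, hU i hi]
  · rcases Γ.adj_sides hij with ⟨hi, hj⟩ | ⟨hj, hi⟩
    · rw [hyI i hi, hyJ j hj]
      linarith [hE i j hi hij h]
    · have h' : s(j, i) ∉ M := by rwa [Sym2.eq_swap]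
      rw [hyI j hi, hyJ i hj, Sym2.eq_swap]
      linarith [hE j i hi hij.symm h']
  · rcases Γ.adj_sides (hM.1.adj h) with ⟨hi, hj⟩ | ⟨hj, hi⟩
    · rw [hyI i hi, hyJ j hj]
      linarith [hE' i j hi h]
    · have h' : s(j, i) ∈ M := by rwa [Sym2.eq_swap]
      rw [hyI j hi, hyJ i hj, Sym2.eq_swap]
      linarith [hE' j i hi h']

/-- Each matched buyer is paid her dual value and the seller keeps the rest of the weight, which is
at least his dual value. So utilities dominate dual values at positive capacities, and these cover
the edges outside `M`. -/
theorem IsMaxWeightBMatching.exists_isStable (hM : Γ.IsMaxWeightBMatching M) :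
    ∃ p, Γ.IsStable M p := by
  classical
  obtain ⟨y, h0, hU, hE, hE'⟩ := hM.exists_dual
  set p : N → N → ℝ := fun i j =>
    if s(i, j) ∈ M then if i ∈ Γ.I then Γ.w s(i, j) - y j else y i else 0 with hp
  have hyp : ∀ i j, s(i, j) ∈ M → y i ≤ p i j := fun i j h => by
    simp only [hp, h, if_true]
    split_ifs
    · linarith [hE' i j h]
    · exact le_rfl
  have hpay : Γ.IsPayoff M p := by
    refine ⟨fun i j => ?_, fun i j h => ?_, fun i j h => if_neg h⟩
    · by_cases h : s(i, j) ∈ M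
      · exact (h0 i).trans (hyp i j h)
      · exact (if_neg h).ge
    · have h' : s(j, i) ∈ M := by rwa [Sym2.eq_swap]
      rcases Γ.adj_sides (hM.1.adj h) with ⟨hi, hj⟩ | ⟨hj, hi⟩
      · simp [hp, h, h', hi, Γ.notMem_I_of_mem_J hj]
      · simp [hp, h, hi, Γ.notMem_I_of_mem_J hj, Sym2.eq_swap (a := j)]
  have hu : ∀ i, Γ.b i ≠ 0 → y i ≤ Γ.realUtility M p i := fun i hb => by
    by_cases h : (partners M i).card = Γ.b i
    · obtain ⟨j, hj, e⟩ := Γ.exists_realUtility_eq p hb h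
      exact e ▸ hyp i j hj
    · rw [hU i (lt_of_le_of_ne (hM.1.2 i) h)]
      exact Γ.realUtility_nonneg hM.1 hpay i
  refine ⟨p, hM.1, hpay, fun i j => Γ.not_blocks hM.1 fun hij h hi hj => ?_⟩
  exact (hE i j hij h).trans (add_le_add (hu i hi) (hu j hj))

end StrongDuality

end MPAInstance

namespace MPAInstance

variable {N : Type*} [Fintype N] {Γ : MPAInstance N}

/-! ### Infima and suprema of payoffs on one matching -/

section Lattice

theorem realUtility_mono {M : Finset (Sym2 N)} {p q : N → N → ℝ} {i : N} (hM : Γ.IsBMatching M)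
    (hp : Γ.IsPayoff M p) (hb : Γ.b i ≠ 0) (h : ∀ j, s(i, j) ∈ M → p i j ≤ q i j) :
    Γ.realUtility M p i ≤ Γ.realUtility M q i := by
  by_cases hc : (partners M i).card = Γ.b i
  · obtain ⟨j, hj, e⟩ := Γ.exists_realUtility_eq q hb hc
    rw [e]
    exact (Γ.realUtility_le hM hp hj).trans (h j hj)
  · rw [Γ.realUtility_of_not_saturated p hc, Γ.realUtility_of_not_saturated q hc]

/-- The sides `A` and `B` are the two partition classes of `Γ`, in one order or the other. -/
def IsSides (Γ : MPAInstance N) (A B : Set N) : Prop :=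
  (∀ i, i ∈ A ∨ i ∈ B) ∧ ∀ i j, Γ.G.Adj i j → (i ∈ A ∧ j ∈ B) ∨ (i ∈ B ∧ j ∈ A)

omit [Fintype N] in
theorem isSides (Γ : MPAInstance N) : Γ.IsSides Γ.I Γ.J :=
  ⟨Γ.mem_I_or_J, fun _ _ h => Γ.adj_sides h⟩

omit [Fintype N] in
theorem isSides' (Γ : MPAInstance N) : Γ.IsSides Γ.J Γ.I :=
  ⟨fun i => (Γ.mem_I_or_J i).symm, fun _ _ h => (Γ.adj_sides h).symm⟩

/-- A nonempty family of stable payoff vectors for one matching may be replaced by its infima for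
one side of the market and its suprema for the other. -/
theorem IsSides.isStable_of_isGLB {A B : Set N} (hAB : Γ.IsSides A B) {M : Finset (Sym2 N)}
    {S : Set (N → N → ℝ)} (hne : S.Nonempty) (hS : ∀ p ∈ S, Γ.IsStable M p) {q : N → N → ℝ}
    (hA : ∀ i ∈ A, ∀ j, IsGLB ((fun p : N → N → ℝ => p i j) '' S) (q i j))
    (hB : ∀ i ∈ B, ∀ j, IsLUB ((fun p : N → N → ℝ => p i j) '' S) (q i j)) :
    Γ.IsStable M q := by
  obtain ⟨p₀, hp₀⟩ := hne
  have hM := (hS p₀ hp₀).1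
  have hqA : ∀ i ∈ A, ∀ j, ∀ p ∈ S, q i j ≤ p i j := fun i hi j p hp =>
    (hA i hi j).1 ⟨p, hp, rfl⟩
  have hqB : ∀ i ∈ B, ∀ j, ∀ p ∈ S, p i j ≤ q i j := fun i hi j p hp =>
    (hB i hi j).1 ⟨p, hp, rfl⟩
  have hleA : ∀ i ∈ A, ∀ j x, (∀ p ∈ S, x ≤ p i j) → x ≤ q i j := fun i hi j x h =>
    (hA i hi j).2 (by rintro _ ⟨p, hp, rfl⟩; exact h p hp)
  have hleB : ∀ i ∈ B, ∀ j x, (∀ p ∈ S, p i j ≤ x) → q i j ≤ x := fun i hi j x h =>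
    (hB i hi j).2 (by rintro _ ⟨p, hp, rfl⟩; exact h p hp)
  have hsum : ∀ i j, i ∈ A → j ∈ B → s(i, j) ∈ M → q i j + q j i = Γ.w s(i, j) := by
    intro i j hi hj h
    have e : ∀ p ∈ S, p i j + p j i = Γ.w s(i, j) := fun p hp => (hS p hp).2.1.2.1 i j h
    have h1 := hleA i hi j (Γ.w s(i, j) - q j i) fun p hp => by
      linarith [e p hp, hqB j hj i p hp]
    have h2 := hleB j hj i (Γ.w s(i, j) - q i j) fun p hp => by
      linarith [e p hp, hqA i hi j p hp]
    linarith
  have hq : Γ.IsPayoff M q := by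
    refine ⟨fun i j => ?_, fun i j h => ?_, fun i j h => ?_⟩
    · rcases hAB.1 i with hi | hi
      · exact hleA i hi j 0 fun p hp => (hS p hp).2.1.1 i j
      · exact ((hS p₀ hp₀).2.1.1 i j).trans (hqB i hi j p₀ hp₀)
    · rcases hAB.2 i j (hM.adj h) with ⟨hi, hj⟩ | ⟨hi, hj⟩
      · exact hsum i j hi hj h
      · rw [add_comm, Sym2.eq_swap]
        exact hsum j i hj hi (by rwa [Sym2.eq_swap])
    · have e : ∀ p ∈ S, p i j = 0 := fun p hp => (hS p hp).2.1.2.2 i j h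
      rcases hAB.1 i with hi | hi
      · exact le_antisymm ((hqA i hi j p₀ hp₀).trans (e p₀ hp₀).le)
          (hleA i hi j 0 fun p hp => (e p hp).ge)
      · exact le_antisymm (hleB i hi j 0 fun p hp => (e p hp).le)
          ((e p₀ hp₀).ge.trans (hqB i hi j p₀ hp₀))
  have hno : ∀ i j, i ∈ A → j ∈ B → Γ.G.Adj i j → s(i, j) ∉ M → Γ.b i ≠ 0 → Γ.b j ≠ 0 →
      Γ.w s(i, j) ≤ Γ.realUtility M q i + Γ.realUtility M q j := by
    intro i j hi hj hij h hbi hbj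
    -- Utilities on the side `B` only grow in passing from `p` to `q`, so this bound on the utility
    -- of `i` is uniform in `p` and passes to the infimum.
    have hp : ∀ p ∈ S, Γ.w s(i, j) - Γ.realUtility M q j ≤ Γ.realUtility M p i := fun p hp => by
      have h1 := (hS p hp).le_add hij h hbi hbj
      have h2 := realUtility_mono (q := q) hM (hS p hp).2.1 hbj fun k _ => hqB j hj k p hp
      linarith
    rw [← sub_le_iff_le_add]
    by_cases hc : (partners M i).card = Γ.b i
    · obtain ⟨k, hk, e⟩ := Γ.exists_realUtility_eq q hbi hc
      rw [e]
      exact hleA i hi k _ fun p hpS =>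
        (hp p hpS).trans (Γ.realUtility_le hM (hS p hpS).2.1 hk)
    · have := hp p₀ hp₀
      rwa [Γ.realUtility_of_not_saturated _ hc] at this ⊢
  refine ⟨hM, hq, fun i j => Γ.not_blocks hM fun hij h hbi hbj => ?_⟩
  rcases hAB.2 i j hij with ⟨hi, hj⟩ | ⟨hi, hj⟩
  · exact hno i j hi hj hij h hbi hbj
  · rw [add_comm, Sym2.eq_swap]
    exact hno j i hj hi hij.symm (by rwa [Sym2.eq_swap]) hbj hbi

theorem IsSides.exists_isGLB {A B : Set N} (hAB : Γ.IsSides A B) (hd : Disjoint A B)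
    {M : Finset (Sym2 N)} {S : Set (N → N → ℝ)} (hne : S.Nonempty)
    (hS : ∀ p ∈ S, Γ.IsStable M p) :
    ∃ q, Γ.IsStable M q ∧
      (∀ i ∈ A, ∀ j, IsGLB ((fun p : N → N → ℝ => p i j) '' S) (q i j)) ∧
      (∀ i ∈ B, ∀ j, IsLUB ((fun p : N → N → ℝ => p i j) '' S) (q i j)) := by
  classical
  have h1 : ∀ i ∈ A, ∀ j, IsGLB ((fun p : N → N → ℝ => p i j) '' S)
      (sInf ((fun p : N → N → ℝ => p i j) '' S)) := fun i _ j =>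
    isGLB_csInf (hne.image _) ⟨0, by rintro _ ⟨p, hp, rfl⟩; exact (hS p hp).2.1.1 i j⟩
  have h2 : ∀ i ∈ B, ∀ j, IsLUB ((fun p : N → N → ℝ => p i j) '' S)
      (sSup ((fun p : N → N → ℝ => p i j) '' S)) := fun i _ j => by
    -- The `0` serves the pairs outside `M`, where `w` may be negative.
    refine isLUB_csSup (hne.image _) ⟨max (Γ.w s(i, j)) 0, ?_⟩
    rintro _ ⟨p, hp, rfl⟩
    by_cases h : s(i, j) ∈ M
    · exact le_max_of_le_left (by linarith [(hS p hp).2.1.2.1 i j h, (hS p hp).2.1.1 j i])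
    · exact le_max_of_le_right ((hS p hp).2.1.2.2 i j h).le
  set q : N → N → ℝ := fun i j => if i ∈ A then sInf ((fun p : N → N → ℝ => p i j) '' S)
    else sSup ((fun p : N → N → ℝ => p i j) '' S) with hq
  have hqA : ∀ i ∈ A, ∀ j, IsGLB ((fun p : N → N → ℝ => p i j) '' S) (q i j) := fun i hi j => by
    simpa [hq, hi] using h1 i hi j
  have hqB : ∀ i ∈ B, ∀ j, IsLUB ((fun p : N → N → ℝ => p i j) '' S) (q i j) := fun i hi j => by
    simpa [hq, Set.disjoint_right.1 hd hi] using h2 i hi j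
  exact ⟨q, hAB.isStable_of_isGLB hne hS hqA hqB, hqA, hqB⟩

end Lattice

/-! ### The order on classes, its bounds and the optimal solutions -/

section Order

/-- On pairs common to both matchings the payoffs agree; on the others they equal the utilities,
which are monotone in the payoffs. So the comparison does not depend on the common matching. -/
theorem PayoffLE.of_equivalent {s t s' t' : Γ.StableSolution} (hs : Γ.Equivalent s s')
    (ht : Γ.Equivalent t t') (hst : s.matching = t.matching) (hst' : s'.matching = t'.matching)
    (h : Γ.PayoffLE s'.payoff t'.payoff) : Γ.PayoffLE s.payoff t.payoff := by
  have key : ∀ {s t s' t' : Γ.StableSolution}, Γ.Equivalent s s' → Γ.Equivalent t t' →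
      s.matching = t.matching → s'.matching = t'.matching → ∀ i,
      (∀ j, s'.payoff i j ≤ t'.payoff i j) → ∀ j, s.payoff i j ≤ t.payoff i j := by
    intro s t s' t' hs ht hst hst' i h j
    by_cases hj : s(i, j) ∈ s.matching
    · by_cases hj' : s(i, j) ∈ s'.matching
      · rw [hs.2.1 i j hj hj', ht.2.1 i j (hst ▸ hj) (hst' ▸ hj')]
        exact h j
      · have hb := s.stable.1.cap_ne_zero hj
        have e1 := hs.2.2.1 i j hj hj'
        have e2 := ht.2.2.1 i j (hst ▸ hj) (hst' ▸ hj')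
        rw [hs.1 i, Γ.utility_eq_coe _ _ hb] at e1
        rw [ht.1 i, Γ.utility_eq_coe _ _ hb] at e2
        have e1' : s.payoff i j = Γ.realUtility s'.matching s'.payoff i := by exact_mod_cast e1
        have e2' : t.payoff i j = Γ.realUtility t'.matching t'.payoff i := by exact_mod_cast e2
        rw [e1', e2', ← hst']
        exact realUtility_mono s'.stable.1 s'.stable.2.1 hb fun k _ => h k
    · rw [s.stable.2.1.2.2 i j hj, t.stable.2.1.2.2 i j (hst ▸ hj)]
  exact ⟨fun i hi => key ht hs hst.symm hst'.symm i (h.1 i hi),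
    fun i hi => key hs ht hst hst' i (h.2 i hi)⟩

theorem stablePayoffLE_iff {s t : Γ.StableSolution} (hst : s.matching = t.matching) :
    Γ.StablePayoffLE s.toPayoff t.toPayoff ↔ Γ.PayoffLE s.payoff t.payoff := by
  constructor
  · rintro ⟨s', t', hs, ht, hst', h⟩
    exact h.of_equivalent (StableSolution.toPayoff_eq_iff.1 hs.symm)
      (StableSolution.toPayoff_eq_iff.1 ht.symm) hst hst'
  · exact fun h => ⟨s, t, rfl, rfl, hst, h⟩

theorem exists_toPayoff_eq {M : Finset (Sym2 N)} (hM : Γ.IsMaxWeightBMatching M)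
    (x : Γ.StablePayoff) : ∃ s : Γ.StableSolution, s.matching = M ∧ s.toPayoff = x :=
  (existsUnique_toPayoff_eq hM x).exists

theorem PayoffLE.antisymm {s t : Γ.StableSolution} (hst : s.matching = t.matching)
    (h : Γ.PayoffLE s.payoff t.payoff) (h' : Γ.PayoffLE t.payoff s.payoff) : s = t := by
  refine StableSolution.ext hst (funext₂ fun i j => ?_)
  rcases Γ.mem_I_or_J i with hi | hi
  · exact le_antisymm (h'.1 i hi j) (h.1 i hi j)
  · exact le_antisymm (h.2 i hi j) (h'.2 i hi j)

/-- The partial order on the classes of stable payoff vectors. -/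
@[reducible]
def stablePartialOrder (Γ : MPAInstance N) : PartialOrder Γ.StablePayoff where
  le := Γ.StablePayoffLE
  le_refl x := by
    induction x using Quotient.inductionOn with | _ t =>
    exact (stablePayoffLE_iff (s := t) (t := t) rfl).2 ⟨fun _ _ _ => le_rfl, fun _ _ _ => le_rfl⟩
  le_trans x y z := by
    obtain ⟨M, hM⟩ := Γ.exists_isMaxWeightBMatching
    obtain ⟨s, hs, rfl⟩ := exists_toPayoff_eq hM x
    obtain ⟨t, ht, rfl⟩ := exists_toPayoff_eq hM y
    obtain ⟨r, hr, rfl⟩ := exists_toPayoff_eq hM z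
    intro h h'
    rw [stablePayoffLE_iff (by rw [hs, ht])] at h
    rw [stablePayoffLE_iff (by rw [ht, hr])] at h'
    rw [stablePayoffLE_iff (by rw [hs, hr])]
    exact ⟨fun i hi j => (h'.1 i hi j).trans (h.1 i hi j),
      fun i hi j => (h.2 i hi j).trans (h'.2 i hi j)⟩
  le_antisymm x y := by
    obtain ⟨M, hM⟩ := Γ.exists_isMaxWeightBMatching
    obtain ⟨s, hs, rfl⟩ := exists_toPayoff_eq hM x
    obtain ⟨t, ht, rfl⟩ := exists_toPayoff_eq hM y
    intro h h'
    rw [stablePayoffLE_iff (by rw [hs, ht])] at h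
    rw [stablePayoffLE_iff (by rw [hs, ht])] at h'
    rw [h.antisymm (by rw [hs, ht]) h']

attribute [local instance] stablePartialOrder

theorem isLUB_toPayoff {M : Finset (Sym2 N)} {S : Set (N → N → ℝ)}
    (hS : ∀ p ∈ S, Γ.IsStable M p) {r : Γ.StableSolution} (hr : r.matching = M)
    (hI : ∀ i ∈ Γ.I, ∀ j, IsGLB ((fun p : N → N → ℝ => p i j) '' S) (r.payoff i j))
    (hJ : ∀ i ∈ Γ.J, ∀ j, IsLUB ((fun p : N → N → ℝ => p i j) '' S) (r.payoff i j)) :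
    IsLUB {x : Γ.StablePayoff | ∃ s : Γ.StableSolution, s.matching = M ∧ s.payoff ∈ S ∧
      s.toPayoff = x} r.toPayoff := by
  constructor
  · rintro _ ⟨s, hs, hsS, rfl⟩
    refine (stablePayoffLE_iff (hs.trans hr.symm)).2 ⟨fun i hi j => ?_, fun i hi j => ?_⟩
    · exact (hI i hi j).1 ⟨_, hsS, rfl⟩
    · exact (hJ i hi j).1 ⟨_, hsS, rfl⟩
  · intro y hy
    obtain ⟨t, ht, rfl⟩ := exists_toPayoff_eq (hr ▸ r.isMaxWeight : Γ.IsMaxWeightBMatching M) y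
    have h : ∀ p ∈ S, Γ.PayoffLE p t.payoff := fun p hp =>
      (stablePayoffLE_iff (s := ⟨M, p, hS p hp⟩) ht.symm).1 (hy ⟨⟨M, p, hS p hp⟩, rfl, hp, rfl⟩)
    refine (stablePayoffLE_iff (hr.trans ht.symm)).2 ⟨fun i hi j => ?_, fun i hi j => ?_⟩
    · exact (hI i hi j).2 (by rintro _ ⟨p, hp, rfl⟩; exact (h p hp).1 i hi j)
    · exact (hJ i hi j).2 (by rintro _ ⟨p, hp, rfl⟩; exact (h p hp).2 i hi j)

theorem isGLB_toPayoff {M : Finset (Sym2 N)} {S : Set (N → N → ℝ)}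
    (hS : ∀ p ∈ S, Γ.IsStable M p) {r : Γ.StableSolution} (hr : r.matching = M)
    (hJ : ∀ i ∈ Γ.J, ∀ j, IsGLB ((fun p : N → N → ℝ => p i j) '' S) (r.payoff i j))
    (hI : ∀ i ∈ Γ.I, ∀ j, IsLUB ((fun p : N → N → ℝ => p i j) '' S) (r.payoff i j)) :
    IsGLB {x : Γ.StablePayoff | ∃ s : Γ.StableSolution, s.matching = M ∧ s.payoff ∈ S ∧
      s.toPayoff = x} r.toPayoff := by
  constructor
  · rintro _ ⟨s, hs, hsS, rfl⟩
    refine (stablePayoffLE_iff (hr.trans hs.symm)).2 ⟨fun i hi j => ?_, fun i hi j => ?_⟩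
    · exact (hI i hi j).1 ⟨_, hsS, rfl⟩
    · exact (hJ i hi j).1 ⟨_, hsS, rfl⟩
  · intro y hy
    obtain ⟨t, ht, rfl⟩ := exists_toPayoff_eq (hr ▸ r.isMaxWeight : Γ.IsMaxWeightBMatching M) y
    have h : ∀ p ∈ S, Γ.PayoffLE t.payoff p := fun p hp =>
      (stablePayoffLE_iff (t := ⟨M, p, hS p hp⟩) ht).1 (hy ⟨⟨M, p, hS p hp⟩, rfl, hp, rfl⟩)
    refine (stablePayoffLE_iff (ht.trans hr.symm)).2 ⟨fun i hi j => ?_, fun i hi j => ?_⟩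
    · exact (hI i hi j).2 (by rintro _ ⟨p, hp, rfl⟩; exact (h p hp).1 i hi j)
    · exact (hJ i hi j).2 (by rintro _ ⟨p, hp, rfl⟩; exact (h p hp).2 i hi j)

/-- The payoff vectors for the matching `M` whose classes belong to `X`. -/
def payoffsIn (M : Finset (Sym2 N)) (X : Set Γ.StablePayoff) : Set (N → N → ℝ) :=
  {p | ∃ h : Γ.IsStable M p, StableSolution.toPayoff ⟨M, p, h⟩ ∈ X}

theorem setOf_toPayoff_eq {M : Finset (Sym2 N)} (hM : Γ.IsMaxWeightBMatching M)
    (X : Set Γ.StablePayoff) :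
    {x : Γ.StablePayoff | ∃ s : Γ.StableSolution, s.matching = M ∧
      s.payoff ∈ payoffsIn M X ∧ s.toPayoff = x} = X := by
  ext x
  constructor
  · rintro ⟨s, rfl, ⟨_, h⟩, rfl⟩
    exact h
  · intro hx
    obtain ⟨s, rfl, rfl⟩ := exists_toPayoff_eq hM x
    exact ⟨s, rfl, ⟨s.stable, hx⟩, rfl⟩

theorem exists_isGLB_stablePayoff {X : Set Γ.StablePayoff} (hX : X.Nonempty) :
    ∃ x, IsGLB X x := by
  obtain ⟨M, hM⟩ := Γ.exists_isMaxWeightBMatching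
  obtain ⟨x, hx⟩ := hX
  obtain ⟨s, rfl, rfl⟩ := exists_toPayoff_eq hM x
  have hS : ∀ p ∈ payoffsIn s.matching X, Γ.IsStable s.matching p := fun p hp => hp.1
  have hne : (payoffsIn s.matching X).Nonempty := ⟨s.payoff, s.stable, hx⟩
  obtain ⟨q, hq, h1, h2⟩ := Γ.isSides'.exists_isGLB Γ.bipartite.disjoint.symm hne hS
  rw [← setOf_toPayoff_eq hM X]
  exact ⟨_, isGLB_toPayoff hS (r := ⟨s.matching, q, hq⟩) rfl h1 h2⟩

theorem exists_isLUB_stablePayoff (X : Set Γ.StablePayoff) : ∃ x, IsLUB X x := by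
  obtain ⟨M, hM⟩ := Γ.exists_isMaxWeightBMatching
  rcases X.eq_empty_or_nonempty with rfl | ⟨x, hx⟩
  -- The supremum of the empty set is the infimum of all classes, which exists because there is a
  -- stable solution.
  · obtain ⟨p, hp⟩ := hM.exists_isStable
    obtain ⟨x, hx⟩ := exists_isGLB_stablePayoff (Γ := Γ) (X := Set.univ)
      ⟨StableSolution.toPayoff ⟨M, p, hp⟩, trivial⟩
    exact ⟨x, by simp, fun y _ => hx.1 trivial⟩
  obtain ⟨s, rfl, rfl⟩ := exists_toPayoff_eq hM x
  have hS : ∀ p ∈ payoffsIn s.matching X, Γ.IsStable s.matching p := fun p hp => hp.1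
  have hne : (payoffsIn s.matching X).Nonempty := ⟨s.payoff, s.stable, hx⟩
  obtain ⟨q, hq, h1, h2⟩ := Γ.isSides.exists_isGLB Γ.bipartite.disjoint hne hS
  rw [← setOf_toPayoff_eq hM X]
  exact ⟨_, isLUB_toPayoff hS (r := ⟨s.matching, q, hq⟩) rfl h1 h2⟩

theorem setOf_toPayoff_pair (s t : Γ.StableSolution) (hst : s.matching = t.matching) :
    {x : Γ.StablePayoff | ∃ r : Γ.StableSolution, r.matching = s.matching ∧
      r.payoff ∈ ({s.payoff, t.payoff} : Set (N → N → ℝ)) ∧ r.toPayoff = x} =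
      {s.toPayoff, t.toPayoff} := by
  ext x
  constructor
  · rintro ⟨r, hr, h | h, rfl⟩
    · exact Or.inl (congrArg _ (StableSolution.ext hr h))
    · exact Or.inr (congrArg _ (StableSolution.ext (hr.trans hst) h))
  · rintro (rfl | rfl)
    · exact ⟨s, rfl, Or.inl rfl, rfl⟩
    · exact ⟨t, hst.symm, Or.inr rfl, rfl⟩

theorem isStable_of_mem_pair {s t : Γ.StableSolution} (hst : s.matching = t.matching) :
    ∀ p ∈ ({s.payoff, t.payoff} : Set (N → N → ℝ)), Γ.IsStable s.matching p := by
  rintro p (rfl | rfl)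
  · exact s.stable
  · exact hst ▸ t.stable

theorem exists_isLUB_joinPayoff {s t : Γ.StableSolution} (hst : s.matching = t.matching) :
    ∃ r : Γ.StableSolution, r.matching = s.matching ∧
      r.payoff = Γ.joinPayoff s.payoff t.payoff ∧
      IsLUB {s.toPayoff, t.toPayoff} r.toPayoff := by
  have hI : ∀ i ∈ Γ.I, ∀ j, IsGLB ((fun p : N → N → ℝ => p i j) '' {s.payoff, t.payoff})
      (Γ.joinPayoff s.payoff t.payoff i j) := fun i hi j => by
    rw [Set.image_pair, joinPayoff, if_pos hi]
    exact isGLB_pair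
  have hJ : ∀ i ∈ Γ.J, ∀ j, IsLUB ((fun p : N → N → ℝ => p i j) '' {s.payoff, t.payoff})
      (Γ.joinPayoff s.payoff t.payoff i j) := fun i hi j => by
    rw [Set.image_pair, joinPayoff, if_neg (Γ.notMem_I_of_mem_J hi)]
    exact isLUB_pair
  have hS := isStable_of_mem_pair hst
  refine ⟨⟨s.matching, _,
    Γ.isSides.isStable_of_isGLB ⟨s.payoff, Or.inl rfl⟩ hS hI hJ⟩, rfl, rfl, ?_⟩
  rw [← setOf_toPayoff_pair s t hst]
  exact isLUB_toPayoff hS rfl hI hJ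

theorem exists_isGLB_meetPayoff {s t : Γ.StableSolution} (hst : s.matching = t.matching) :
    ∃ r : Γ.StableSolution, r.matching = s.matching ∧
      r.payoff = Γ.meetPayoff s.payoff t.payoff ∧
      IsGLB {s.toPayoff, t.toPayoff} r.toPayoff := by
  have hI : ∀ i ∈ Γ.I, ∀ j, IsLUB ((fun p : N → N → ℝ => p i j) '' {s.payoff, t.payoff})
      (Γ.meetPayoff s.payoff t.payoff i j) := fun i hi j => by
    rw [Set.image_pair, meetPayoff, if_pos hi]
    exact isLUB_pair
  have hJ : ∀ i ∈ Γ.J, ∀ j, IsGLB ((fun p : N → N → ℝ => p i j) '' {s.payoff, t.payoff})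
      (Γ.meetPayoff s.payoff t.payoff i j) := fun i hi j => by
    rw [Set.image_pair, meetPayoff, if_neg (Γ.notMem_I_of_mem_J hi)]
    exact isGLB_pair
  have hS := isStable_of_mem_pair hst
  refine ⟨⟨s.matching, _,
    Γ.isSides'.isStable_of_isGLB ⟨s.payoff, Or.inl rfl⟩ hS hJ hI⟩, rfl, rfl, ?_⟩
  rw [← setOf_toPayoff_pair s t hst]
  exact isGLB_toPayoff hS rfl hJ hI

/-- Termwise inequality with the reverse inequality of sums forces equality on the side `A`; the
payoffs on the other side are determined by the weights. -/
theorem eq_of_totalPayoff_le {A B : Set N} (hAB : Γ.IsSides A B) {s t : Γ.StableSolution}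
    (hst : s.matching = t.matching) (h : ∀ i ∈ A, ∀ j, s.payoff i j ≤ t.payoff i j)
    (h' : ∀ i ∈ A, Γ.totalPayoff t.payoff i ≤ Γ.totalPayoff s.payoff i) : s = t := by
  have hA : ∀ i ∈ A, ∀ j, s(i, j) ∈ s.matching → s.payoff i j = t.payoff i j := by
    intro i hi j hj
    have h1 := h' i hi
    rw [s.totalPayoff_eq, t.totalPayoff_eq, ← hst] at h1
    exact (Finset.sum_eq_sum_iff_of_le fun j _ => h i hi j).1
      (le_antisymm (Finset.sum_le_sum fun j _ => h i hi j) h1) j (mem_partners.2 hj)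
  refine StableSolution.ext hst (funext₂ fun i j => ?_)
  by_cases hj : s(i, j) ∈ s.matching
  · rcases hAB.2 i j (s.stable.1.adj hj) with ⟨hi, -⟩ | ⟨-, hjA⟩
    · exact hA i hi j hj
    · have h1 := hA j hjA i (by rwa [Sym2.eq_swap])
      have h2 := s.stable.2.1.2.1 i j hj
      have h3 := t.stable.2.1.2.1 i j (hst ▸ hj)
      linarith
  · rw [s.stable.2.1.2.2 i j hj, t.stable.2.1.2.2 i j (hst ▸ hj)]

/-- A stable solution is optimal for one side of the market if and only if its class is the one
that is best for this side pair by pair. -/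
theorem isOptimalFor_iff {A B : Set N} (hAB : Γ.IsSides A B) {x : Γ.StablePayoff}
    (hx : ∀ s t : Γ.StableSolution, s.matching = t.matching → t.toPayoff = x →
      ∀ i ∈ A, ∀ j, s.payoff i j ≤ t.payoff i j) (s : Γ.StableSolution) :
    Γ.IsOptimalFor A s ↔ s.toPayoff = x := by
  constructor
  · intro h
    obtain ⟨t, ht, rfl⟩ := exists_toPayoff_eq s.isMaxWeight x
    rw [eq_of_totalPayoff_le hAB ht.symm (hx s t ht.symm rfl)
      fun i hi => not_lt.1 fun hlt => h ⟨t, i, hi, hlt⟩]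
  · rintro hs ⟨t, i, hi, hlt⟩
    -- Total payoffs depend only on the class, so `t` may be compared on the matching of `s`.
    have ht := t.equivalent_transfer s.isMaxWeight
    rw [← ht.totalPayoff_eq i] at hlt
    exact absurd (Finset.sum_le_sum fun j _ => hx (t.transfer s.isMaxWeight) s rfl hs i hi j)
      (not_le.2 hlt)

end Order

end MPAInstance

theorem theorem10 {N : Type*} [Fintype N] (Γ : MPAInstance N) :
    -- every class has exactly one payoff vector for each maximum weight `b`-matching
    (∀ M, Γ.IsMaxWeightBMatching M → ∀ x : Γ.StablePayoff,
      ∃! s : Γ.StableSolution, s.matching = M ∧ s.toPayoff = x) ∧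
    -- for a common matching, the order of the classes is the comparison pair by pair
    (∀ s t : Γ.StableSolution, s.matching = t.matching →
      (Γ.StablePayoffLE s.toPayoff t.toPayoff ↔ Γ.PayoffLE s.payoff t.payoff)) ∧
    -- the stable payoff vectors form a complete lattice
    ∃ L : CompleteLattice Γ.StablePayoff,
      (∀ x y : Γ.StablePayoff, L.le x y ↔ Γ.StablePayoffLE x y) ∧
      -- with the payoff-wise join and meet
      (∀ s t : Γ.StableSolution, s.matching = t.matching →
        (∃ r : Γ.StableSolution, r.matching = s.matching ∧
          r.payoff = Γ.joinPayoff s.payoff t.payoff ∧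
          r.toPayoff = L.sup s.toPayoff t.toPayoff) ∧
        (∃ r : Γ.StableSolution, r.matching = s.matching ∧
          r.payoff = Γ.meetPayoff s.payoff t.payoff ∧
          r.toPayoff = L.inf s.toPayoff t.toPayoff)) ∧
      -- and with unique optimal outcomes for both sides
      (∀ s : Γ.StableSolution, Γ.IsOptimalFor Γ.I s ↔ s.toPayoff = L.bot) ∧
      (∀ s : Γ.StableSolution, Γ.IsOptimalFor Γ.J s ↔ s.toPayoff = L.top) := by
  let := Γ.stablePartialOrder
  choose f hf using MPAInstance.exists_isLUB_stablePayoff (Γ := Γ)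
  let : SupSet Γ.StablePayoff := ⟨f⟩
  let L : CompleteLattice Γ.StablePayoff := completeLatticeOfSup _ hf
  refine ⟨fun M hM x => MPAInstance.existsUnique_toPayoff_eq hM x,
    fun s t hst => MPAInstance.stablePayoffLE_iff hst, L, fun x y => Iff.rfl,
    fun s t hst => ⟨?_, ?_⟩, fun s => ?_, fun s => ?_⟩
  · obtain ⟨r, h1, h2, h3⟩ := MPAInstance.exists_isLUB_joinPayoff hst
    exact ⟨r, h1, h2, h3.unique isLUB_pair⟩
  · obtain ⟨r, h1, h2, h3⟩ := MPAInstance.exists_isGLB_meetPayoff hst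
    exact ⟨r, h1, h2, h3.unique isGLB_pair⟩
  · refine MPAInstance.isOptimalFor_iff Γ.isSides (fun s t hst ht => ?_) s
    -- Sellers' payoffs decrease along the order, so the bottom class is their best one.
    have hle : t.toPayoff ≤ s.toPayoff := ht ▸ bot_le
    exact ((MPAInstance.stablePayoffLE_iff hst.symm).1 hle).1
  · refine MPAInstance.isOptimalFor_iff Γ.isSides' (fun s t hst ht => ?_) s
    have hle : s.toPayoff ≤ t.toPayoff := ht ▸ le_top
    exact ((MPAInstance.stablePayoffLE_iff hst).1 hle).2
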